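/- Identify $\mathbb R^2$ with $\mathbb C$ and let $(r,\theta)$ be polar coordinates with $\theta\in(-\frac{\pi}{2},\frac{3\pi}{2}]$. There exist a bounded domain $\Omega\subset\mathbb R^2$ with $0\in\partial\Omega$, two nonconstant connected curves $\Gamma_d,\Gamma_n\subset\partial\Omega$ (open in $\partial\Omega$), and a function $u$ with the following properties. (1) The boundary of $\Omega$ is of class $C^1$ near each of its points, the exterior unit normal at $0$ is $(0,-1)$, and for no $\delta>0$ is $\partial\Omega$ of class $C^{1,\delta}$ near $0$ (hence for no $\delta>0$ is it of class $C^{2,\delta}$ near $0$). The curve $\Gamma_d$ lies in $\{x_1>0\}$, the curve $\Gamma_n$ lies in $\{x_1<0\}$, $\overline{\Gamma_d}\cap\overline{\Gamma_n}=\{0\}$, and $\partial\Omega$ coincides with $\Gamma_d\cup\{0\}\cup\Gamma_n$ near $0$. (2) $u\in H^1(\Omega)\cap C(\overline\Omega)$, $u$ is harmonic in a neighbourhood of $\overline\Omega\setminus\{0\}$ (in particular in $\Omega$), $u=0$ on $\Gamma_d$, and $\partial u/\partial\nu=0$ on $\Gamma_n$. (3) On $\overline\Omega\setminus\{0\}$,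 $$u=r^{3/2}\Big[\tfrac34(\log r)\sin\big(\tfrac32\theta\big)+\big(\tfrac34\theta-\tfrac{\pi}{2}\big)\cos\big(\tfrac32\theta\big)\Big],$$ so that $u=\tfrac34\, r^{3/2}(\log r)\sin(\tfrac32\theta)+O(r^{3/2})$ as $r\to0$ in $\Omega$: the dominant term at the junction $0$ is of order $r^{3/2}\log r$. (4) Consequently $u$ has no log-free expansion at $0$, in the following two senses. (a) For every $\theta\in(0,\pi)$ with $\theta\ne\frac{2\pi}{3}$ and every finite sum $\sum_j c_j r^{\gamma_j}$ with real $c_j,\gamma_j$, the difference $u(re^{i\theta})-\sum_j c_j r^{\gamma_j}$ is not $o(r^{3/2}|\log r|)$ as $r\to0^+$. (b) Let $F_k=r^{\frac{2k-1}{2}}\sin\big(\tfrac{2k-1}{2}\theta\big)$ for $k\ge1$; in the upper half-plane these are the homogeneous harmonic functions that vanish on $\{x_1>0,\,x_2=0\}$ and have zero normal derivative on $\{x_1<0,\,x_2=0\}$. For all $k\ge 1$, all $\beta\neq0$ and every map $\varphi:\mathbb C\to\mathbb C$ with $\varphi(0)=0$ and $\varphi(z)=\alpha z+o(|z|)$ as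 $z\to 0$ in $\Omega$, for some real $\alpha>0$, the difference $u-\beta F_k\circ\varphi$ is not $o(|z|^{\frac{2k-1}{2}})$ as $z\to0$ in $\Omega$. -/

import Mathlib

open Set Filter Topology MeasureTheory Asymptotics
open scoped NNReal

/-! The plane is identified with `ℂ` (Euclidean norm, Lebesgue measure), `x₁ + i x₂` being the
point `(x₁, x₂)`. -/

/-- `G` is a `C¹` defining function of `Ω` in `U`: its gradient has no zero in `U` and, inside `U`,
the set `Ω` is the sublevel set `{G < 0}`. -/
def IsDefiningFunctionOn (Ω U : Set ℂ) (G : ℂ → ℝ) : Prop :=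
  ContDiffOn ℝ 1 G U ∧ (∀ z ∈ U, fderiv ℝ G z ≠ 0) ∧ Ω ∩ U = {z ∈ U | G z < 0}

/-- The boundary of `Ω` is of class `C¹` near its boundary point `p`. -/
def BoundaryC1At (Ω : Set ℂ) (p : ℂ) : Prop :=
  ∃ (U : Set ℂ) (G : ℂ → ℝ), IsOpen U ∧ p ∈ U ∧ IsDefiningFunctionOn Ω U G

/-- The boundary of `Ω` is of class `C^{k,δ}` near its boundary point `p` (here `1 ≤ k`): there is
a local defining function of class `C^k` with `δ`-Hölder derivatives of order `k`. -/
def BoundaryHolderAt (k : ℕ) (δ : ℝ≥0) (Ω : Set ℂ) (p : ℂ) : Prop :=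
  ∃ (U : Set ℂ) (G : ℂ → ℝ), IsOpen U ∧ p ∈ U ∧ IsDefiningFunctionOn Ω U G ∧
    ContDiffOn ℝ k G U ∧ ∃ C : ℝ≥0, HolderOnWith C δ (iteratedFDeriv ℝ k G) U

/-- `ν` is the exterior unit normal vector to `∂Ω` at the boundary point `p`: the unit vector that
is a positive multiple of the gradient at `p` of a local defining function. -/
def IsOuterUnitNormal (Ω : Set ℂ) (p ν : ℂ) : Prop :=
  p ∈ frontier Ω ∧ ‖ν‖ = 1 ∧
    ∃ (U : Set ℂ) (G : ℂ → ℝ), IsOpen U ∧ p ∈ U ∧ IsDefiningFunctionOn Ω U G ∧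
      ∃ c : ℝ, 0 < c ∧ ∀ v : ℂ, fderiv ℝ G p v = c * inner ℝ ν v

/-- `Γ` is a nonconstant curve contained in `∂Ω` and open in `∂Ω`. -/
def IsBoundaryArc (Ω Γ : Set ℂ) : Prop :=
  IsConnected Γ ∧ Γ.Nontrivial ∧ ∃ V : Set ℂ, IsOpen V ∧ Γ = frontier Ω ∩ V

/-- `Ω` is a bounded planar domain with `0 ∈ ∂Ω`, and `Γd` and `Γn` are two boundary arcs that meet
exactly at the junction `0`; the exterior unit normal at `0` is `(0, -1)`, the arc `Γd` is on the
right of `0` and `Γn` on its left, and near `0` they exhaust the boundary. -/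
structure IsJunctionDomain (Ω Γd Γn : Set ℂ) : Prop where
  isOpen : IsOpen Ω
  isConnected : IsConnected Ω
  isBounded : Bornology.IsBounded Ω
  normal_zero : IsOuterUnitNormal Ω 0 (-Complex.I)
  arc_d : IsBoundaryArc Ω Γd
  arc_n : IsBoundaryArc Ω Γn
  right_d : ∀ z ∈ Γd, 0 < z.re
  left_n : ∀ z ∈ Γn, z.re < 0
  closure_inter : closure Γd ∩ closure Γn = {0}
  near_zero : ∃ ε : ℝ, 0 < ε ∧ frontier Ω ∩ Metric.ball 0 ε ⊆ Γd ∪ {0} ∪ Γn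

/-- `u` is continuous on the closure of `Ω`, harmonic in an open set containing
`closure Ω \ {0}`, belongs to `H¹(Ω)`, vanishes on `Γd` and has zero normal derivative on `Γn`.
(As `u` is smooth in `Ω`, its weak gradient in `Ω` is the classical one.) -/
structure IsMixedHarmonic (Ω Γd Γn : Set ℂ) (u : ℂ → ℝ) : Prop where
  continuousOn : ContinuousOn u (closure Ω)
  harmonic : InnerProductSpace.HarmonicOnNhd u (closure Ω \ {0})
  memLp : MemLp u 2 (volume.restrict Ω)
  memLp_grad : MemLp (fun z => fderiv ℝ u z) 2 (volume.restrict Ω)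
  dirichlet : ∀ p ∈ Γd, u p = 0
  neumann : ∀ p ∈ Γn, ∃ ν : ℂ, IsOuterUnitNormal Ω p ν ∧ fderiv ℝ u p ν = 0

/-- The polar angle with values in `(-π/2, 3π/2]`, continuous off the half-line
`{(0, x₂) | x₂ ≤ 0}`. -/
noncomputable def polarAngle (z : ℂ) : ℝ := Complex.arg (-Complex.I * z) + Real.pi / 2

/-- The function `r^{(2k-1)/2} sin((2k-1)θ/2)`. In the upper half-plane these (for `k ≥ 1`) are the
homogeneous harmonic functions that vanish on the right half of the boundary and have zero normal
derivative on the left half. -/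
noncomputable def mixedProfile (k : ℕ) (z : ℂ) : ℝ :=
  ‖z‖ ^ ((2 * (k : ℝ) - 1) / 2) * Real.sin ((2 * (k : ℝ) - 1) / 2 * polarAngle z)

/-!
The solution is the imaginary part of the holomorphic function
`f z = z ^ (3/2) * (3/4 * log z - I * π/2)` (`logPotential`), with the branch of the logarithm whose
imaginary part is `polarAngle`. Its formula in polar coordinates, its continuity at `0` and the bound
for its gradient are read off from `f`, and so are the statements about single rays: on the ray at
angle `θ`, the solution is `r ^ (3/2) * (A * log r + B)` with `A = 3/4 * sin (3θ/2)`, where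
`A = 0` only for `θ = 2π/3`, and no finite sum of powers of `r` is asymptotic to a nonzero multiple of
`log r` (`not_tendsto_sum_rpow_div_log`). On the ray `θ = π/2` the leading term of
`mixedProfile k ∘ φ` is a pure power of `r`, which does not match `A * log r` either
(`logSolution_sub_mixedProfile_comp_not_isLittleO`).

The domain is designed so that `Im f` vanishes on the right part of its boundary and `Re f` on the
left part. By the Cauchy-Riemann equations the latter gives the Neumann condition for `Im f`
(`fderiv_logSolution_normal_eq_zero`). Both zero sets have the same shape: for the points
`(± x, - x * s)` with `x > 0` and `a = arctan s`, the equation is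
`-log r * sin (3a/2) = (c + a) * cos (3a/2)`, where `c = 2π/3` on the right and `c = π/3` on the left.
Solved for `-1 / log x`, it becomes `slopeFun c s = -1 / log x` with a function `slopeFun c` that is
smooth near `s = 0`, vanishes there and has derivative `3/(2c) ≠ 0`. The inverse function theorem
gives `s = S (-1 / log x)` with `S` of class `C¹`, so the boundary is the graph of
`h x = -|x| * S (-1 / log |x|)`, with one `S` on each side (`exists_boundary_graph`). Such an `h` is of
class `C¹` with `h' 0 = 0`, because `x * (-1 / log x)' = (-1 / log x) ^ 2` tends to `0`
(`contDiffAt_logTwist`), but `h x * log x / x` has a nonzero limit at `0⁺`. A defining function with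
Hölder gradient would force `h x = O(x ^ (1 + δ))`, which is incompatible with that limit
(`false_of_gradient_holder`).

To close up the boundary, start with the points at distance less than `ε` from a square of side `2ε`.
This is a convex set with a `C¹` defining function whose boundary is flat near `0`. The shear
`(x, y) ↦ (x, y + h x)` is a `C¹` diffeomorphism of the plane that preserves all topological
properties needed, turns the flat part of the boundary into the graph of `h` and fixes the imaginary
axis pointwise; hence the closure of the domain meets the branch cut of the logarithm only at `0`
(`mem_slit_of_mem_closure`).
-/

/-! ### Polar coordinates and the branch of the logarithm -/

/-- The branch of the complex logarithm with imaginary part `polarAngle`. It is holomorphic off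
`{(0, x₂) | x₂ ≤ 0}`, that is, where `-I * z` lies in the slit plane. -/
noncomputable def slitLog (z : ℂ) : ℂ := Complex.log (-Complex.I * z) + Complex.I * (Real.pi / 2)

theorem slitLog_re (z : ℂ) : (slitLog z).re = Real.log ‖z‖ := by
  simp [slitLog, Complex.log_re]

theorem slitLog_im (z : ℂ) : (slitLog z).im = polarAngle z := by
  have : ((Real.pi : ℂ) / 2).re = Real.pi / 2 := by norm_num
  simp [slitLog, polarAngle, Complex.log_im, this]

theorem abs_polarAngle_le (z : ℂ) : |polarAngle z| ≤ 3 * Real.pi / 2 := by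
  unfold polarAngle
  have h1 := Complex.neg_pi_lt_arg (-Complex.I * z)
  have h2 := Complex.arg_le_pi (-Complex.I * z)
  rw [abs_le]; constructor <;> linarith [Real.pi_pos]

theorem polarAngle_polar {r θ : ℝ} (hr : 0 < r) (hθ : θ ∈ Ioc (-(Real.pi / 2)) (3 * Real.pi / 2)) :
    polarAngle (r * Complex.exp (θ * Complex.I)) = θ := by
  have hE : -Complex.I * (r * Complex.exp (θ * Complex.I)) =
      r * (Complex.cos ((θ - Real.pi / 2 : ℝ)) + Complex.sin ((θ - Real.pi / 2 : ℝ)) * Complex.I) := by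
    rw [← Complex.exp_mul_I]
    push_cast
    rw [sub_mul, Complex.exp_sub, Complex.exp_pi_div_two_mul_I, div_eq_mul_inv, Complex.inv_I]
    ring
  rw [polarAngle, hE, Complex.arg_mul_cos_add_sin_mul_I hr ⟨by linarith [hθ.1], by linarith [hθ.2]⟩]
  ring

theorem polarAngle_real_mul {r : ℝ} (hr : 0 < r) (z : ℂ) :
    polarAngle (r * z) = polarAngle z := by
  unfold polarAngle
  rw [mul_left_comm, Complex.arg_real_mul _ hr]

theorem mixedProfile_real_mul {r : ℝ} (hr : 0 < r) (k : ℕ) (z : ℂ) :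
    mixedProfile k (r * z) = r ^ ((2 * (k : ℝ) - 1) / 2) * mixedProfile k z := by
  unfold mixedProfile
  rw [polarAngle_real_mul hr, norm_mul, Complex.norm_real, Real.norm_of_nonneg hr.le,
    Real.mul_rpow hr.le (norm_nonneg _), mul_assoc]

theorem mem_slit_iff {z : ℂ} : -Complex.I * z ∈ Complex.slitPlane ↔ 0 < z.im ∨ z.re ≠ 0 := by
  simp [Complex.mem_slitPlane_iff]

theorem hasDerivAt_slitLog {z : ℂ} (hz : -Complex.I * z ∈ Complex.slitPlane) :
    HasDerivAt slitLog z⁻¹ z := by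
  have h : HasDerivAt (fun w : ℂ => -Complex.I * w) (-Complex.I) z := by
    simpa using (hasDerivAt_id z).const_mul (-Complex.I)
  refine ((h.clog hz).add_const (Complex.I * (Real.pi / 2))).congr_deriv ?_
  rw [div_mul_cancel_left₀ (neg_ne_zero.2 Complex.I_ne_zero)]

/-! ### The solution as an imaginary part -/

/-- The holomorphic function `z ^ (3/2) * (3/4 * log z - I * π/2)`. -/
noncomputable def logPotential (z : ℂ) : ℂ :=
  Complex.exp (3 / 2 * slitLog z) * (3 / 4 * slitLog z - Complex.I * (Real.pi / 2))

/-- The derivative of `logPotential`. -/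
noncomputable def logPotentialDeriv (z : ℂ) : ℂ :=
  Complex.exp (3 / 2 * slitLog z) * z⁻¹ *
    (9 / 8 * slitLog z - Complex.I * (3 * Real.pi / 4) + 3 / 4)

/-- The explicit solution of the mixed problem, in polar coordinates; its value at `0` is `0`. -/
noncomputable def logSolution (z : ℂ) : ℝ :=
  ‖z‖ ^ (3 / 2 : ℝ) *
    (3 / 4 * Real.log ‖z‖ * Real.sin (3 / 2 * polarAngle z) +
      (3 / 4 * polarAngle z - Real.pi / 2) * Real.cos (3 / 2 * polarAngle z))

theorem exp_slitLog {z : ℂ} (hz : z ≠ 0) :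
    Complex.exp (3 / 2 * slitLog z) = ((‖z‖ ^ (3 / 2 : ℝ) * Real.cos (3 / 2 * polarAngle z) : ℝ) : ℂ)
      + ((‖z‖ ^ (3 / 2 : ℝ) * Real.sin (3 / 2 * polarAngle z) : ℝ) : ℂ) * Complex.I := by
  have hL : 3 / 2 * slitLog z =
      ((3 / 2 * Real.log ‖z‖ : ℝ) : ℂ) + ((3 / 2 * polarAngle z : ℝ) : ℂ) * Complex.I := by
    rw [← slitLog_re, ← slitLog_im]
    conv_lhs => rw [← Complex.re_add_im (slitLog z)]
    push_cast; ring
  rw [hL, Complex.exp_add, Complex.exp_mul_I, ← Complex.ofReal_exp, ← Complex.ofReal_cos,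
    ← Complex.ofReal_sin, Real.rpow_def_of_pos (norm_pos_iff.2 hz)]
  push_cast; ring_nf

theorem logPotential_eq {z : ℂ} (hz : z ≠ 0) :
    logPotential z = ((‖z‖ ^ (3 / 2 : ℝ) * (3 / 4 * Real.log ‖z‖ * Real.cos (3 / 2 * polarAngle z) -
        (3 / 4 * polarAngle z - Real.pi / 2) * Real.sin (3 / 2 * polarAngle z)) : ℝ) : ℂ)
      + (logSolution z : ℂ) * Complex.I := by
  rw [logPotential, exp_slitLog hz, logSolution]
  conv_lhs => rw [← Complex.re_add_im (slitLog z), slitLog_re, slitLog_im]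
  push_cast
  linear_combination ((‖z‖ ^ (3 / 2 : ℝ) : ℝ) : ℂ) * Complex.sin (3 / 2 * polarAngle z) *
    (3 / 4 * polarAngle z - Real.pi / 2) * Complex.I_sq

theorem logPotential_im {z : ℂ} (hz : z ≠ 0) : (logPotential z).im = logSolution z := by
  rw [logPotential_eq hz, Complex.add_im, Complex.ofReal_im, Complex.im_ofReal_mul, Complex.I_im,
    zero_add, mul_one]

theorem logPotential_re {z : ℂ} (hz : z ≠ 0) :
    (logPotential z).re = ‖z‖ ^ (3 / 2 : ℝ) * (3 / 4 * Real.log ‖z‖ *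
      Real.cos (3 / 2 * polarAngle z) -
        (3 / 4 * polarAngle z - Real.pi / 2) * Real.sin (3 / 2 * polarAngle z)) := by
  rw [logPotential_eq hz, Complex.add_re, Complex.ofReal_re, Complex.re_ofReal_mul, Complex.I_re,
    mul_zero, add_zero]

theorem hasDerivAt_logPotential {z : ℂ} (hz : -Complex.I * z ∈ Complex.slitPlane) :
    HasDerivAt logPotential (logPotentialDeriv z) z := by
  have h := hasDerivAt_slitLog hz
  refine ((h.const_mul (3 / 2)).cexp.mul ((h.const_mul (3 / 4)).sub_const
    (Complex.I * (Real.pi / 2)))).congr_deriv ?_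
  rw [logPotentialDeriv]; ring

theorem isOpen_slit : IsOpen {z : ℂ | -Complex.I * z ∈ Complex.slitPlane} :=
  Complex.isOpen_slitPlane.preimage (by fun_prop)

theorem ne_zero_of_mem_slit {z : ℂ} (hz : -Complex.I * z ∈ Complex.slitPlane) : z ≠ 0 := by
  rintro rfl; simp at hz

theorem logSolution_eventuallyEq {z : ℂ} (hz : -Complex.I * z ∈ Complex.slitPlane) :
    logSolution =ᶠ[𝓝 z] fun w => (logPotential w).im := by
  filter_upwards [isOpen_slit.mem_nhds hz] with w hw
  exact (logPotential_im (ne_zero_of_mem_slit hw)).symm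

theorem harmonicAt_logSolution {z : ℂ} (hz : -Complex.I * z ∈ Complex.slitPlane) :
    InnerProductSpace.HarmonicAt logSolution z := by
  have hA : AnalyticAt ℂ logPotential z := by
    refine DifferentiableOn.analyticAt (s := {z : ℂ | -Complex.I * z ∈ Complex.slitPlane}) ?_
      (isOpen_slit.mem_nhds hz)
    exact fun w hw => (hasDerivAt_logPotential hw).differentiableAt.differentiableWithinAt
  exact (InnerProductSpace.harmonicAt_congr_nhds (logSolution_eventuallyEq hz)).2 hA.harmonicAt_im

theorem fderiv_logSolution {z : ℂ} (hz : -Complex.I * z ∈ Complex.slitPlane) (v : ℂ) :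
    fderiv ℝ logSolution z v = (logPotentialDeriv z * v).im := by
  have h1 := ((hasDerivAt_logPotential hz).hasFDerivAt).restrictScalars ℝ
  have h2 := (Complex.imCLM.hasFDerivAt.comp z h1).congr_of_eventuallyEq
    (logSolution_eventuallyEq hz)
  rw [h2.fderiv]
  simp [mul_comm]

theorem norm_fderiv_logSolution_le {z : ℂ} (hz : -Complex.I * z ∈ Complex.slitPlane) :
    ‖fderiv ℝ logSolution z‖ ≤ ‖logPotentialDeriv z‖ := by
  refine ContinuousLinearMap.opNorm_le_bound _ (norm_nonneg _) fun v => ?_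
  rw [fderiv_logSolution hz, Real.norm_eq_abs, ← norm_mul]
  exact Complex.abs_im_le_norm _

theorem norm_logPotentialDeriv_le {z : ℂ} (hz : z ≠ 0) :
    ‖logPotentialDeriv z‖ ≤
      9 / 4 * |√‖z‖ * Real.log √‖z‖| + √‖z‖ * (9 / 8 * (3 * Real.pi / 2) + 3 * Real.pi / 4 + 1) := by
  have hr : 0 < ‖z‖ := norm_pos_iff.2 hz
  have h1 : ‖Complex.exp (3 / 2 * slitLog z) * z⁻¹‖ = √‖z‖ := by
    rw [norm_mul, Complex.norm_exp, norm_inv]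
    have : (3 / 2 * slitLog z).re = 3 / 2 * Real.log ‖z‖ := by
      rw [← slitLog_re]; simp
    rw [this, Real.sqrt_eq_rpow, mul_comm (3 / 2 : ℝ), ← Real.rpow_def_of_pos hr,
      ← Real.rpow_neg_one ‖z‖, ← Real.rpow_add hr]
    norm_num
  have h2 : ‖slitLog z‖ ≤ |Real.log ‖z‖| + 3 * Real.pi / 2 := by
    have := Complex.norm_le_abs_re_add_abs_im (slitLog z)
    rw [slitLog_re, slitLog_im] at this
    linarith [abs_polarAngle_le z]
  have h3 : ‖9 / 8 * slitLog z - Complex.I * (3 * Real.pi / 4) + 3 / 4‖ ≤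
      9 / 8 * (|Real.log ‖z‖| + 3 * Real.pi / 2) + 3 * Real.pi / 4 + 1 := by
    refine (norm_add_le _ _).trans (add_le_add ((norm_sub_le _ _).trans (add_le_add ?_ ?_)) ?_)
    · rw [norm_mul]; norm_num; linarith
    · simp [abs_of_pos Real.pi_pos]
    · norm_num
  rw [logPotentialDeriv, norm_mul, h1, abs_mul, abs_of_nonneg (Real.sqrt_nonneg _), Real.log_sqrt hr.le,
    abs_div, abs_of_pos (two_pos : (0 : ℝ) < 2)]
  nlinarith [mul_le_mul_of_nonneg_left h3 (Real.sqrt_nonneg ‖z‖)]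

theorem exists_bound_logPotentialDeriv (R : ℝ) :
    ∃ C, ∀ z : ℂ, z ≠ 0 → ‖z‖ ≤ R → ‖logPotentialDeriv z‖ ≤ C := by
  have hc : Continuous fun r : ℝ => 9 / 4 * |√r * Real.log √r| +
      √r * (9 / 8 * (3 * Real.pi / 2) + 3 * Real.pi / 4 + 1) :=
    (((Real.continuous_mul_log.comp Real.continuous_sqrt).abs).const_mul _ |>.add
      (Real.continuous_sqrt.mul continuous_const))
  obtain ⟨C, hC⟩ := (isCompact_Icc (a := (0 : ℝ)) (b := R)).bddAbove_image hc.continuousOn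
  exact ⟨C, fun z hz hR => (norm_logPotentialDeriv_le hz).trans
    (hC ⟨‖z‖, ⟨norm_nonneg _, hR⟩, rfl⟩)⟩

theorem continuousAt_logSolution_zero : ContinuousAt logSolution 0 := by
  have h0 : logSolution 0 = 0 := by simp [logSolution]
  have hc : Continuous fun r : ℝ => 3 / 4 * (√r * |r * Real.log r|) + r ^ (3 / 2 : ℝ) * (2 * Real.pi) :=
    ((Real.continuous_sqrt.mul Real.continuous_mul_log.abs).const_mul _).add
      ((Real.continuous_rpow_const (by norm_num)).mul continuous_const)
  have hl : Tendsto (fun z : ℂ => 3 / 4 * (√‖z‖ * |‖z‖ * Real.log ‖z‖|) +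
      ‖z‖ ^ (3 / 2 : ℝ) * (2 * Real.pi)) (𝓝 0) (𝓝 0) := by
    have := (hc.comp (continuous_norm (E := ℂ))).tendsto 0
    simpa [Function.comp_def] using this
  rw [ContinuousAt, h0]
  refine squeeze_zero_norm (fun z => ?_) hl
  have hr := norm_nonneg z
  have hs : ‖z‖ ^ (3 / 2 : ℝ) = √‖z‖ * ‖z‖ := by
    rw [Real.sqrt_eq_rpow, show (3 / 2 : ℝ) = 1 / 2 + 1 by norm_num,
      Real.rpow_add_one' hr (by norm_num)]
  have hp : 0 ≤ ‖z‖ ^ (3 / 2 : ℝ) := by positivity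
  have h1 : |3 / 4 * Real.log ‖z‖ * Real.sin (3 / 2 * polarAngle z) +
      (3 / 4 * polarAngle z - Real.pi / 2) * Real.cos (3 / 2 * polarAngle z)| ≤
      3 / 4 * |Real.log ‖z‖| + 2 * Real.pi := by
    refine (abs_add_le _ _).trans (add_le_add ?_ ?_)
    · rw [abs_mul, abs_mul, abs_of_pos (by norm_num : (0 : ℝ) < 3 / 4)]
      exact mul_le_of_le_one_right (by positivity) (Real.abs_sin_le_one _)
    · rw [abs_mul]
      refine (mul_le_of_le_one_right (by positivity) (Real.abs_cos_le_one _)).trans ?_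
      have := abs_le.1 (abs_polarAngle_le z)
      rw [abs_le]; constructor <;> linarith [Real.pi_pos]
  rw [logSolution, Real.norm_eq_abs, abs_mul, abs_of_nonneg hp]
  refine (mul_le_mul_of_nonneg_left h1 hp).trans (le_of_eq ?_)
  rw [abs_mul, abs_of_nonneg hr, mul_add]
  nth_rw 1 [hs]
  ring

theorem logSolution_sub_isBigO (l : Filter ℂ) :
    (fun z => logSolution z - 3 / 4 * Real.log ‖z‖ * mixedProfile 2 z)
      =O[l] fun z => ‖z‖ ^ (3 / 2 : ℝ) := by
  refine IsBigO.of_bound (2 * Real.pi) (Eventually.of_forall fun z => ?_)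
  have hE : logSolution z - 3 / 4 * Real.log ‖z‖ * mixedProfile 2 z =
      ((3 / 4 * polarAngle z - Real.pi / 2) * Real.cos (3 / 2 * polarAngle z)) *
        ‖z‖ ^ (3 / 2 : ℝ) := by
    rw [logSolution, mixedProfile, show (2 * ((2 : ℕ) : ℝ) - 1) / 2 = 3 / 2 by norm_num]; ring
  rw [hE, norm_mul]
  refine mul_le_mul_of_nonneg_right ?_ (norm_nonneg _)
  rw [Real.norm_eq_abs, abs_mul]
  refine (mul_le_of_le_one_right (by positivity) (Real.abs_cos_le_one _)).trans ?_
  have := abs_le.1 (abs_polarAngle_le z)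
  rw [abs_le]; constructor <;> linarith [Real.pi_pos]

/-! ### Behaviour on rays -/

theorem logSolution_polar {r θ : ℝ} (hr : 0 < r)
    (hθ : θ ∈ Ioc (-(Real.pi / 2)) (3 * Real.pi / 2)) :
    logSolution (r * Complex.exp (θ * Complex.I)) = r ^ (3 / 2 : ℝ) *
      (3 / 4 * Real.log r * Real.sin (3 / 2 * θ) +
        (3 / 4 * θ - Real.pi / 2) * Real.cos (3 / 2 * θ)) := by
  rw [logSolution, polarAngle_polar hr hθ, norm_mul, Complex.norm_exp_ofReal_mul_I,
    Complex.norm_real, Real.norm_of_nonneg hr.le, mul_one]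

/-- A finite sum of real powers with some nonzero coefficient is equivalent at `0⁺` to its term of
lowest exponent, so it cannot be equivalent to a nonzero multiple of the logarithm. -/
theorem not_tendsto_sum_rpow_div_log {A : ℝ} (hA : A ≠ 0) (s : Finset ℝ) (c : ℝ → ℝ) :
    ¬ Tendsto (fun r : ℝ => (∑ γ ∈ s, c γ * r ^ γ) / Real.log r) (𝓝[>] 0) (𝓝 A) := by
  intro h
  set t := s.filter (fun γ => c γ ≠ 0) with ht
  have hsum : ∀ r : ℝ, ∑ γ ∈ s, c γ * r ^ γ = ∑ γ ∈ t, c γ * r ^ γ := by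
    intro r
    rw [ht, Finset.sum_filter]
    refine Finset.sum_congr rfl fun γ _ => ?_
    by_cases hc : c γ = 0 <;> simp [hc]
  simp only [hsum] at h
  rcases t.eq_empty_or_nonempty with h0 | hne
  · rw [h0] at h
    simp only [Finset.sum_empty, zero_div] at h
    exact hA (tendsto_nhds_unique h tendsto_const_nhds)
  · set m := t.min' hne with hm
    have hmt : m ∈ t := t.min'_mem hne
    have hcm : c m ≠ 0 := (Finset.mem_filter.1 hmt).2
    have hlow : Tendsto (fun r : ℝ => (∑ γ ∈ t, c γ * r ^ γ) * r ^ (-m)) (𝓝[>] 0) (𝓝 (c m)) := by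
      have h1 : Tendsto (fun r : ℝ => ∑ γ ∈ t, c γ * r ^ (γ - m)) (𝓝[>] 0)
          (𝓝 (∑ γ ∈ t, if γ = m then c m else 0)) := by
        refine tendsto_finsetSum _ fun γ hγ => ?_
        split_ifs with hγm
        · subst hγm; simp
        · have hpos : 0 < γ - m := sub_pos.2 (lt_of_le_of_ne (t.min'_le γ hγ) (Ne.symm hγm))
          have := ((Real.continuousAt_rpow_const 0 _ (Or.inr hpos.le)).tendsto.mono_left
            (nhdsWithin_le_nhds (s := Ioi 0))).const_mul (c γ)
          simpa [Real.zero_rpow hpos.ne'] using this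
      rw [Finset.sum_ite_eq' t m, if_pos hmt] at h1
      refine h1.congr' ?_
      filter_upwards [self_mem_nhdsWithin] with r hr
      rw [Finset.sum_mul]
      refine Finset.sum_congr rfl fun γ _ => ?_
      rw [sub_eq_add_neg, Real.rpow_add hr, mul_assoc]
    have hne0 : ∀ᶠ r : ℝ in 𝓝[>] 0, Real.log r ≠ 0 := by
      filter_upwards [Ioo_mem_nhdsGT (zero_lt_one (α := ℝ))] with r hr
      exact (Real.log_neg hr.1 hr.2).ne
    rcases lt_or_ge m 0 with hm0 | hm0
    · -- negative lowest exponent: the sum beats the logarithm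
      have h2 := h.mul (tendsto_log_mul_rpow_nhdsGT_zero (neg_pos.2 hm0))
      rw [mul_zero] at h2
      refine hcm (tendsto_nhds_unique hlow (h2.congr' ?_))
      filter_upwards [hne0] with r hr
      field_simp
    · -- nonnegative lowest exponent: the sum stays bounded
      have h3 : Tendsto (fun r : ℝ => r ^ m * (Real.log r)⁻¹) (𝓝[>] 0) (𝓝 0) := by
        have hb := ((Real.continuousAt_rpow_const 0 m (Or.inr hm0)).tendsto.mono_left
          (nhdsWithin_le_nhds (s := Ioi 0)))
        have := hb.mul (tendsto_inv_atBot_zero.comp Real.tendsto_log_nhdsGT_zero)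
        simpa using this
      have h4 := hlow.mul h3
      rw [mul_zero] at h4
      refine hA (tendsto_nhds_unique h (h4.congr' ?_))
      filter_upwards [self_mem_nhdsWithin] with r hr
      rw [mul_assoc, ← mul_assoc (r ^ (-m)), ← Real.rpow_add hr]
      simp [div_eq_mul_inv]

theorem logSolution_ray_not_isLittleO {θ : ℝ} (hθ : θ ∈ Ioo 0 Real.pi)
    (hθ' : θ ≠ 2 * Real.pi / 3) (s : Finset ℝ) (c : ℝ → ℝ) :
    ¬ ((fun r : ℝ => logSolution (r * Complex.exp (θ * Complex.I)) - ∑ γ ∈ s, c γ * r ^ γ)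
      =o[𝓝[>] 0] fun r : ℝ => r ^ (3 / 2 : ℝ) * Real.log r) := by
  intro h
  have hs : Real.sin (3 / 2 * θ) ≠ 0 := by
    intro h0
    have hne : 3 / 2 * θ - Real.pi ≠ 0 := fun h1 => hθ' (by linarith)
    have h1 : Real.sin (3 / 2 * θ - Real.pi) = 0 := by rw [Real.sin_sub_pi, h0, neg_zero]
    rw [Real.sin_eq_zero_iff_of_lt_of_lt (by linarith [hθ.1, hθ.2]) (by linarith [hθ.1, hθ.2])] at h1
    exact hne h1
  have hne0 : ∀ᶠ r : ℝ in 𝓝[>] 0, Real.log r ≠ 0 := by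
    filter_upwards [Ioo_mem_nhdsGT (zero_lt_one (α := ℝ))] with r hr
    exact (Real.log_neg hr.1 hr.2).ne
  have hlog : Tendsto (fun r : ℝ => (3 / 4 * θ - Real.pi / 2) * Real.cos (3 / 2 * θ) *
      (Real.log r)⁻¹) (𝓝[>] 0) (𝓝 0) := by
    simpa using (tendsto_inv_atBot_zero.comp Real.tendsto_log_nhdsGT_zero).const_mul
      ((3 / 4 * θ - Real.pi / 2) * Real.cos (3 / 2 * θ))
  have hmain := (hlog.sub h.tendsto_div_nhds_zero).const_add (3 / 4 * Real.sin (3 / 2 * θ))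
  -- divided by `r ^ (3/2)`, the sum of powers is again one, with shifted exponents
  refine not_tendsto_sum_rpow_div_log (A := 3 / 4 * Real.sin (3 / 2 * θ)) (by simpa using hs)
    (s.image (· - 3 / 2)) (fun γ => c (γ + 3 / 2)) ?_
  rw [sub_zero, add_zero] at hmain
  refine hmain.congr' ?_
  filter_upwards [hne0, self_mem_nhdsWithin] with r hr hr0
  have hr0 : 0 < r := hr0
  have hp : 0 < r ^ (3 / 2 : ℝ) := Real.rpow_pos_of_pos hr0 _
  rw [logSolution_polar hr0 ⟨by linarith [hθ.1, Real.pi_pos], by linarith [hθ.2, Real.pi_pos]⟩,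
    Finset.sum_image (fun a _ b _ hab => by simpa using hab)]
  have hsum : ∑ γ ∈ s, c (γ - 3 / 2 + 3 / 2) * r ^ (γ - 3 / 2) =
      (∑ γ ∈ s, c γ * r ^ γ) / r ^ (3 / 2 : ℝ) := by
    rw [Finset.sum_div]
    refine Finset.sum_congr rfl fun γ _ => ?_
    rw [sub_add_cancel, Real.rpow_sub hr0, mul_div_assoc]
  rw [hsum]
  field_simp
  ring

theorem continuousAt_mixedProfile (k : ℕ) {z : ℂ} (hz : -Complex.I * z ∈ Complex.slitPlane) :
    ContinuousAt (mixedProfile k) z := by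
  have h1 : ContinuousAt polarAngle z := by
    have : ContinuousAt (fun z => Complex.arg (-Complex.I * z)) z :=
      ContinuousAt.comp (f := fun z => -Complex.I * z) (Complex.continuousAt_arg hz) (by fun_prop)
    exact this.add continuousAt_const
  have h2 : ContinuousAt (fun z : ℂ => ‖z‖ ^ ((2 * (k : ℝ) - 1) / 2)) z :=
    continuousAt_id.norm.rpow_const (Or.inl (norm_ne_zero_iff.2 (ne_zero_of_mem_slit hz)))
  exact h2.mul (Real.continuous_sin.continuousAt.comp (h1.const_mul _))

/-- Along the positive imaginary axis `mixedProfile k ∘ φ` has a pure power of `r` as its leading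
term, while `logSolution` carries an additional logarithm. -/
theorem logSolution_sub_mixedProfile_comp_not_isLittleO {Ω : Set ℂ}
    (hΩ : ∀ᶠ r : ℝ in 𝓝[>] 0, (r : ℂ) * Complex.I ∈ Ω) {k : ℕ} {β α : ℝ} {φ : ℂ → ℂ}
    (hk : 1 ≤ k) (hβ : β ≠ 0) (hα : 0 < α) (hφ0 : φ 0 = 0)
    (hφ : HasDerivWithinAt φ (α : ℂ) Ω 0) :
    ¬ ((fun z => logSolution z - β * mixedProfile k (φ z))
      =o[𝓝[Ω] 0] fun z => ‖z‖ ^ ((2 * (k : ℝ) - 1) / 2)) := by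
  intro h
  set m : ℝ := (2 * (k : ℝ) - 1) / 2 with hm
  have hray0 : Tendsto (fun r : ℝ => (r : ℂ) * Complex.I) (𝓝[>] 0) (𝓝 0) := by
    have : Continuous fun r : ℝ => (r : ℂ) * Complex.I := by fun_prop
    simpa using (this.tendsto 0).mono_left (nhdsWithin_le_nhds (s := Ioi 0))
  have hray : Tendsto (fun r : ℝ => (r : ℂ) * Complex.I) (𝓝[>] 0) (𝓝[Ω] 0) :=
    tendsto_nhdsWithin_iff.2 ⟨hray0, hΩ⟩
  have h1 := (h.comp_tendsto hray).tendsto_div_nhds_zero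
  -- the direction of `φ` along the ray
  have hdir : Tendsto (fun r : ℝ => φ (r * Complex.I) / r) (𝓝[>] 0) (𝓝 (α * Complex.I)) := by
    have h2 := (hasDerivWithinAt_iff_tendsto_slope.1 hφ)
    have hray' : Tendsto (fun r : ℝ => (r : ℂ) * Complex.I) (𝓝[>] 0) (𝓝[Ω \ {0}] 0) := by
      refine tendsto_nhdsWithin_iff.2 ⟨hray0, ?_⟩
      filter_upwards [hΩ, self_mem_nhdsWithin] with r hr hr0
      have hr0 : 0 < r := hr0
      exact ⟨hr, by simp [hr0.ne']⟩
    refine ((h2.comp hray').mul_const Complex.I).congr' ?_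
    filter_upwards [self_mem_nhdsWithin] with r hr0
    have hr0 : (r : ℂ) ≠ 0 := by exact_mod_cast (show (0 : ℝ) < r from hr0).ne'
    simp only [Function.comp, slope_def_field, hφ0, sub_zero]
    field_simp
  have hslit : -Complex.I * (α * Complex.I) ∈ Complex.slitPlane :=
    mem_slit_iff.2 (Or.inl (by simpa using hα))
  have hprof := (continuousAt_mixedProfile k hslit).tendsto.comp hdir
  have h3 := h1.add (hprof.const_mul β)
  have hexp : Complex.exp ((Real.pi / 2 : ℝ) * Complex.I) = Complex.I := by
    push_cast; exact Complex.exp_pi_div_two_mul_I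
  -- hence `logSolution / r ^ m` would have a finite limit along the ray
  have h4 : Tendsto (fun r : ℝ => r ^ (3 / 2 - m) *
      (3 / 4 * Real.log r * Real.sin (3 / 2 * (Real.pi / 2)) +
        (3 / 4 * (Real.pi / 2) - Real.pi / 2) * Real.cos (3 / 2 * (Real.pi / 2)))) (𝓝[>] 0)
      (𝓝 (β * mixedProfile k (α * Complex.I))) := by
    rw [zero_add] at h3
    refine h3.congr' ?_
    filter_upwards [self_mem_nhdsWithin] with r hr0
    have hr0 : 0 < r := hr0
    have hr0' : (r : ℂ) ≠ 0 := by exact_mod_cast hr0.ne'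
    have e1 : mixedProfile k (φ (r * Complex.I)) =
        r ^ m * mixedProfile k (φ (r * Complex.I) / r) := by
      rw [hm, ← mixedProfile_real_mul hr0, mul_div_cancel₀ _ hr0']
    have e2 := logSolution_polar hr0 (θ := Real.pi / 2)
      ⟨by linarith [Real.pi_pos], by linarith [Real.pi_pos]⟩
    rw [hexp] at e2
    have hp : 0 < r ^ m := Real.rpow_pos_of_pos hr0 _
    simp only [Function.comp]
    rw [e1, e2, norm_mul, Complex.norm_I, Complex.norm_real, Real.norm_of_nonneg hr0.le, mul_one,
      Real.rpow_sub hr0]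
    field_simp
    ring
  have hsin : Real.sin (3 / 2 * (Real.pi / 2)) ≠ 0 :=
    (Real.sin_pos_of_pos_of_lt_pi (by positivity) (by linarith [Real.pi_pos])).ne'
  rcases hk.eq_or_lt with hk1 | hk2
  · -- `k = 1`: the limit of the left side is `0`, but the first profile is positive on the ray
    have hm1 : m = 1 / 2 := by rw [hm, ← hk1]; norm_num
    have h5 : Tendsto (fun r : ℝ => r ^ (3 / 2 - m) *
      (3 / 4 * Real.log r * Real.sin (3 / 2 * (Real.pi / 2)) +
        (3 / 4 * (Real.pi / 2) - Real.pi / 2) * Real.cos (3 / 2 * (Real.pi / 2)))) (𝓝[>] 0)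
        (𝓝 0) := by
      have ha := (tendsto_log_mul_rpow_nhdsGT_zero (r := 1) one_pos).const_mul
        (3 / 4 * Real.sin (3 / 2 * (Real.pi / 2)))
      have hb := ((tendsto_id (α := ℝ) (x := 𝓝 0)).mono_left
        (nhdsWithin_le_nhds (s := Ioi 0))).const_mul
        ((3 / 4 * (Real.pi / 2) - Real.pi / 2) * Real.cos (3 / 2 * (Real.pi / 2)))
      have hab := ha.add hb
      rw [mul_zero, mul_zero, add_zero] at hab
      refine hab.congr fun r => ?_
      rw [hm1]; norm_num; ring
    have h6 := tendsto_nhds_unique h4 h5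
    rw [mixedProfile_real_mul hα, mul_eq_zero, mul_eq_zero] at h6
    have hI : mixedProfile k Complex.I ≠ 0 := by
      have hpa := polarAngle_polar (r := 1) (θ := Real.pi / 2) one_pos
        ⟨by linarith [Real.pi_pos], by linarith [Real.pi_pos]⟩
      rw [hexp, Complex.ofReal_one, one_mul] at hpa
      rw [mixedProfile, hpa, ← hm, hm1, Complex.norm_I, Real.one_rpow, one_mul]
      exact (Real.sin_pos_of_pos_of_lt_pi (by positivity) (by linarith [Real.pi_pos])).ne'
    rcases h6 with h6 | h6 | h6
    · exact hβ h6
    · exact (Real.rpow_pos_of_pos hα _).ne' h6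
    · exact hI h6
  · -- `k ≥ 2`: after division by `r ^ (3/2 - m) * log r`, one side tends to `A ≠ 0`, the other to `0`
    have hm2 : 0 ≤ m - 3 / 2 := by
      have : (2 : ℝ) ≤ k := by exact_mod_cast hk2
      rw [hm]; linarith
    have hinv : Tendsto (fun r : ℝ => (Real.log r)⁻¹) (𝓝[>] 0) (𝓝 0) :=
      tendsto_inv_atBot_zero.comp Real.tendsto_log_nhdsGT_zero
    have hpow := (Real.continuousAt_rpow_const 0 (m - 3 / 2) (Or.inr hm2)).tendsto.mono_left
      (nhdsWithin_le_nhds (s := Ioi 0))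
    have h5 := (h4.mul hpow).mul hinv
    rw [mul_zero] at h5
    have h6 := (hinv.const_mul ((3 / 4 * (Real.pi / 2) - Real.pi / 2) *
      Real.cos (3 / 2 * (Real.pi / 2)))).const_add (3 / 4 * Real.sin (3 / 2 * (Real.pi / 2)))
    rw [mul_zero, add_zero] at h6
    have h7 : 3 / 4 * Real.sin (3 / 2 * (Real.pi / 2)) = 0 := by
      refine tendsto_nhds_unique h6 (h5.congr' ?_)
      filter_upwards [Ioo_mem_nhdsGT (zero_lt_one (α := ℝ))] with r hr
      have hl : Real.log r ≠ 0 := (Real.log_neg hr.1 hr.2).ne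
      have hp : r ^ (3 / 2 - m) * r ^ (m - 3 / 2) = 1 := by
        rw [← Real.rpow_add hr.1]; simp
      rw [mul_right_comm (r ^ (3 / 2 - m)), hp]
      field_simp
    exact hsin (by simpa using h7)

/-! ### Functions of the form `x * S (-1 / log x)` -/

/-- `-1 / log x`, with value `0` at `x = 0`. -/
noncomputable def negInvLog (x : ℝ) : ℝ := -(Real.log x)⁻¹

theorem negInvLog_zero : negInvLog 0 = 0 := by simp [negInvLog]

theorem continuousAt_negInvLog {x : ℝ} (hx : x ∈ Ioo (-1 : ℝ) 1) : ContinuousAt negInvLog x := by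
  by_cases h0 : x = 0
  · subst h0
    rw [← continuousWithinAt_compl_self, ContinuousWithinAt, negInvLog_zero]
    have := (tendsto_inv_atBot_zero.comp Real.tendsto_log_nhdsNE_zero).neg
    rwa [neg_zero] at this
  · exact ((Real.continuousAt_log h0).inv₀
      (Real.log_ne_zero.2 ⟨h0, hx.2.ne, hx.1.ne'⟩)).neg

theorem hasDerivAt_negInvLog {x : ℝ} (hx : x ∈ Ioo (0 : ℝ) 1) :
    HasDerivAt negInvLog (negInvLog x ^ 2 / x) x := by
  have hl : Real.log x ≠ 0 := (Real.log_neg hx.1 hx.2).ne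
  refine ((Real.hasDerivAt_log hx.1.ne').inv hl).neg.congr_deriv ?_
  rw [negInvLog]
  have := hx.1.ne'
  field_simp

/-- The function equal to `x * S (-1 / log x)` for `x > 0` and to `x * S 0` for `x ≤ 0`; it is used with
`S 0 = 0`, when it vanishes on the left half-line. -/
noncomputable def logTwist (S : ℝ → ℝ) (x : ℝ) : ℝ := x * S (negInvLog (max x 0))

theorem logTwist_of_nonneg (S : ℝ → ℝ) {x : ℝ} (hx : 0 ≤ x) :
    logTwist S x = x * S (negInvLog x) := by rw [logTwist, max_eq_left hx]

theorem logTwist_of_nonpos {S : ℝ → ℝ} (hS : S 0 = 0) {x : ℝ} (hx : x ≤ 0) :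
    logTwist S x = 0 := by rw [logTwist, max_eq_right hx, negInvLog_zero, hS, mul_zero]

theorem continuousAt_negInvLog_max {x : ℝ} (hx : x < 1) :
    ContinuousAt (fun y : ℝ => negInvLog (max y 0)) x := by
  refine ContinuousAt.comp (g := negInvLog) (f := fun y : ℝ => max y 0)
    (continuousAt_negInvLog ⟨?_, max_lt hx one_pos⟩) (by fun_prop)
  exact neg_one_lt_zero.trans_le (le_max_right x 0)

theorem hasDerivAt_logTwist_zero {S : ℝ → ℝ} (hS : ContinuousAt S 0) (hS0 : S 0 = 0) :
    HasDerivAt (logTwist S) 0 0 := by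
  have hc : ContinuousAt (fun y : ℝ => S (negInvLog (max y 0))) 0 := by
    refine ContinuousAt.comp (g := S) (f := fun y : ℝ => negInvLog (max y 0)) ?_
      (continuousAt_negInvLog_max one_pos)
    simpa [negInvLog_zero] using hS
  rw [hasDerivAt_iff_tendsto_slope]
  have h1 := hc.tendsto.mono_left (nhdsWithin_le_nhds (s := {0}ᶜ))
  simp only [max_self, negInvLog_zero, hS0] at h1
  refine h1.congr' ?_
  filter_upwards [self_mem_nhdsWithin] with x hx
  have hx : x ≠ 0 := hx
  rw [slope_def_field, logTwist, logTwist]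
  field_simp
  simp

/-- Since `x * (-1 / log x)' = (-1 / log x) ^ 2`, the factor `1 / x` in the derivative of the
logarithm is compensated and the derivative of `logTwist S` is continuous at `0`. -/
theorem contDiffAt_logTwist {S : ℝ → ℝ} (hS : ContDiffAt ℝ 1 S 0) (hS0 : S 0 = 0) :
    ContDiffAt ℝ 1 (logTwist S) 0 := by
  set e : ℝ → ℝ := fun y => negInvLog (max y 0) with he
  have he0 : e 0 = 0 := by simp [he, negInvLog_zero]
  have hec : ∀ x < 1, ContinuousAt e x := fun x hx => continuousAt_negInvLog_max hx
  have hev : ∀ᶠ x in 𝓝 (0 : ℝ), ContDiffAt ℝ 1 S (e x) := by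
    have := hS.eventually (by simp)
    rw [← he0] at this
    exact (hec 0 one_pos).eventually this
  set d : ℝ → ℝ := fun x => S (e x) + deriv S (e x) * e x ^ 2 with hd
  rw [contDiffAt_one_iff]
  refine ⟨fun x => ContinuousLinearMap.toSpanSingleton ℝ (d x), {x | ContDiffAt ℝ 1 S (e x)} ∩ Iio 1,
    inter_mem hev (Iio_mem_nhds one_pos), ?_, ?_⟩
  · rintro x ⟨hxS, hx1⟩
    have hxS : ContDiffAt ℝ 1 S (e x) := hxS
    have h1 : ContinuousAt (fun x => S (e x)) x := hxS.continuousAt.comp (hec x hx1)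
    have h2 : ContinuousAt (deriv S) (e x) :=
      ((hxS.continuousAt_fderiv one_ne_zero).clm_apply (continuousAt_const (y := (1 : ℝ))))
    have h3 : ContinuousAt d x := h1.add ((h2.comp (hec x hx1)).mul ((hec x hx1).pow 2))
    have h4 : Continuous fun a : ℝ => ContinuousLinearMap.toSpanSingleton ℝ a :=
      (ContinuousLinearMap.toSpanSingletonCLE (𝕜 := ℝ) (E := ℝ)).continuous
    exact (h4.continuousAt.comp h3).continuousWithinAt
  · rintro x ⟨hxS, hx1⟩
    have hxS : ContDiffAt ℝ 1 S (e x) := hxS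
    change HasDerivAt (logTwist S) (d x) x
    rcases lt_trichotomy x 0 with h | h | h
    · have hz : d x = 0 := by
        simp [hd, he, max_eq_right h.le, negInvLog_zero, hS0]
      rw [hz]
      refine (hasDerivAt_const x (0 : ℝ)).congr_of_eventuallyEq ?_
      filter_upwards [Iio_mem_nhds h] with y hy
      exact logTwist_of_nonpos hS0 (le_of_lt hy)
    · subst h
      have hz : d 0 = 0 := by simp [hd, he0, hS0]
      rw [hz]
      exact hasDerivAt_logTwist_zero hS.continuousAt hS0
    · have hex : e x = negInvLog x := by simp [he, max_eq_left h.le]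
      have h1 : HasDerivAt S (deriv S (negInvLog x)) (negInvLog x) := by
        rw [← hex]; exact (hxS.differentiableAt one_ne_zero).hasDerivAt
      have h2 := (hasDerivAt_id x).mul (h1.comp x (hasDerivAt_negInvLog ⟨h, hx1⟩))
      have h3 : HasDerivAt (logTwist S) _ x := h2.congr_of_eventuallyEq (by
        filter_upwards [Ioi_mem_nhds h] with y hy
        exact logTwist_of_nonneg S (le_of_lt hy))
      refine h3.congr_deriv ?_
      have := h.ne'
      simp only [hd, hex, id, Function.comp]
      field_simp

/-- A germ of a `C¹` function on the line is the germ of a globally `C¹` function. -/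
theorem exists_contDiff_eventuallyEq {g : ℝ → ℝ} (hg : ContDiffAt ℝ 1 g 0) :
    ∃ h : ℝ → ℝ, ContDiff ℝ 1 h ∧ h =ᶠ[𝓝 0] g := by
  have hev := hg.eventually (by simp)
  obtain ⟨ρ, hρ, hball⟩ := Metric.eventually_nhds_iff_ball.1 hev
  let b : ContDiffBump (0 : ℝ) := ⟨ρ / 3, ρ / 2, by positivity, by linarith⟩
  refine ⟨fun x => b x * g x, contDiff_iff_contDiffAt.2 fun x => ?_, ?_⟩
  · by_cases hx : x ∈ Metric.ball (0 : ℝ) ρ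
    · exact b.contDiff.contDiffAt.mul (hball x hx)
    · have hx' : x ∉ tsupport b := by
        rw [b.tsupport_eq]
        intro h
        exact hx (Metric.closedBall_subset_ball (show ρ / 2 < ρ by linarith) h)
      refine (contDiffAt_const (c := (0 : ℝ))).congr_of_eventuallyEq ?_
      filter_upwards [notMem_tsupport_iff_eventuallyEq.1 hx'] with y hy
      simp [hy]
  · filter_upwards [b.eventuallyEq_one] with x hx
    simp [hx]

/-! ### The boundary curve near the junction -/

/-- With `a = arctan s`, the equation `slopeFun c s = -1 / log x` says that
`-log r * sin (3 * a / 2) = (c + a) * cos (3 * a / 2)` for `r = x * √(1 + s ^ 2)`, which is the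
distance to the origin of the points `(± x, - x * s)`. -/
noncomputable def slopeFun (c s : ℝ) : ℝ :=
  Real.sin (3 / 2 * Real.arctan s) / ((c + Real.arctan s) * Real.cos (3 / 2 * Real.arctan s) +
    1 / 2 * Real.log (1 + s ^ 2) * Real.sin (3 / 2 * Real.arctan s))

theorem slopeFun_eq {c s x : ℝ} (hx : x ∈ Ioo (0 : ℝ) 1) (h : slopeFun c s = negInvLog x) :
    -Real.log (x * √(1 + s ^ 2)) * Real.sin (3 / 2 * Real.arctan s) =
      (c + Real.arctan s) * Real.cos (3 / 2 * Real.arctan s) := by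
  have hl : Real.log x ≠ 0 := (Real.log_neg hx.1 hx.2).ne
  have hs : 0 < 1 + s ^ 2 := by positivity
  have hD : (c + Real.arctan s) * Real.cos (3 / 2 * Real.arctan s) +
      1 / 2 * Real.log (1 + s ^ 2) * Real.sin (3 / 2 * Real.arctan s) ≠ 0 := by
    intro h0
    rw [slopeFun, h0, div_zero, negInvLog] at h
    exact hl (inv_eq_zero.1 (neg_eq_zero.1 h.symm))
  rw [Real.log_mul hx.1.ne' (Real.sqrt_pos.2 hs).ne', Real.log_sqrt hs.le]
  rw [slopeFun, negInvLog, div_eq_iff hD] at h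
  field_simp at h
  ring_nf at h ⊢
  linarith

theorem exists_slopeFun_inverse {c : ℝ} (hc : 0 < c) :
    ∃ (S : ℝ → ℝ) (d : ℝ), ContDiffAt ℝ 1 S 0 ∧ S 0 = 0 ∧ d ≠ 0 ∧ HasDerivAt S d 0 ∧
      ∀ᶠ t in 𝓝 0, slopeFun c (S t) = t := by
  have h0 : slopeFun c 0 = 0 := by simp [slopeFun]
  have hl : ContDiffAt ℝ 1 (fun s : ℝ => Real.log (1 + s ^ 2)) 0 :=
    ContDiffAt.log (by fun_prop) (by norm_num)
  have ha : ContDiffAt ℝ 1 Real.arctan 0 := Real.contDiff_arctan.contDiffAt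
  have hcd : ContDiffAt ℝ 1 (slopeFun c) 0 := by
    have hn : ContDiffAt ℝ 1 (fun s => Real.sin (3 / 2 * Real.arctan s)) 0 :=
      (contDiffAt_const.mul ha).sin
    have hco : ContDiffAt ℝ 1 (fun s => Real.cos (3 / 2 * Real.arctan s)) 0 :=
      (contDiffAt_const.mul ha).cos
    exact hn.div (((contDiffAt_const.add ha).mul hco).add ((contDiffAt_const.mul hl).mul hn))
      (by simp [hc.ne'])
  have hder : HasDerivAt (slopeFun c) (3 / 2 / c) 0 := by
    have hla : HasDerivAt (fun s : ℝ => Real.log (1 + s ^ 2)) 0 0 :=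
      ((((hasDerivAt_id (0 : ℝ)).pow 2).const_add 1).log (by norm_num)).congr_deriv (by simp)
    have haa := Real.hasDerivAt_arctan 0
    have hn := (haa.const_mul (3 / 2)).sin
    have hco := (haa.const_mul (3 / 2)).cos
    refine (hn.div (((haa.const_add c).mul hco).add ((hla.const_mul (1 / 2)).mul hn))
      (by simp [hc.ne'])).congr_deriv ?_
    simp
    field_simp
  have hne : 3 / 2 / c ≠ 0 := by positivity
  have hst : HasStrictDerivAt (slopeFun c) (3 / 2 / c) 0 := hcd.hasStrictDerivAt' hder one_ne_zero
  have hSd := hst.to_localInverse hne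
  have hSr := hst.eventually_right_inverse hne
  have hS0 : hst.localInverse _ _ _ hne (slopeFun c 0) = 0 :=
    (hst.hasStrictFDerivAt_equiv hne).localInverse_apply_image
  have hSc := hcd.to_localInverse (hst.hasStrictFDerivAt_equiv hne).hasFDerivAt one_ne_zero
  rw [h0] at hSd hSr hS0 hSc
  exact ⟨hst.localInverse _ _ _ hne, _, hSc, hS0, inv_ne_zero hne, hSd.hasDerivAt, hSr⟩

theorem polar_of_right (x s : ℝ) :
    (x : ℂ) + ((-(x * s) : ℝ) : ℂ) * Complex.I =
      ((x * √(1 + s ^ 2) : ℝ) : ℂ) * Complex.exp ((-Real.arctan s : ℝ) * Complex.I) := by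
  have hs : √(1 + s ^ 2) ≠ 0 := (Real.sqrt_pos.2 (by positivity)).ne'
  have h1 : x * √(1 + s ^ 2) * Real.cos (-Real.arctan s) = x := by
    rw [Real.cos_neg, Real.cos_arctan]; field_simp
  have h2 : x * √(1 + s ^ 2) * Real.sin (-Real.arctan s) = -(x * s) := by
    rw [Real.sin_neg, Real.sin_arctan]; field_simp
  rw [Complex.exp_mul_I, ← Complex.ofReal_cos, ← Complex.ofReal_sin, mul_add, ← mul_assoc,
    ← Complex.ofReal_mul, ← Complex.ofReal_mul, h1, h2]

theorem polar_of_left (x s : ℝ) :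
    ((-x : ℝ) : ℂ) + ((-(x * s) : ℝ) : ℂ) * Complex.I =
      ((x * √(1 + s ^ 2) : ℝ) : ℂ) * Complex.exp ((Real.pi + Real.arctan s : ℝ) * Complex.I) := by
  have hs : √(1 + s ^ 2) ≠ 0 := (Real.sqrt_pos.2 (by positivity)).ne'
  have h1 : x * √(1 + s ^ 2) * Real.cos (Real.pi + Real.arctan s) = -x := by
    rw [add_comm Real.pi, Real.cos_add_pi, Real.cos_arctan]; field_simp
  have h2 : x * √(1 + s ^ 2) * Real.sin (Real.pi + Real.arctan s) = -(x * s) := by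
    rw [add_comm Real.pi, Real.sin_add_pi, Real.sin_arctan]; field_simp
  rw [Complex.exp_mul_I, ← Complex.ofReal_cos, ← Complex.ofReal_sin, mul_add, ← mul_assoc,
    ← Complex.ofReal_mul, ← Complex.ofReal_mul, h1, h2]

theorem logSolution_eq_zero_of_slopeFun {x s : ℝ} (hx : x ∈ Ioo (0 : ℝ) 1)
    (h : slopeFun (2 * Real.pi / 3) s = negInvLog x) :
    logSolution ((x : ℂ) + ((-(x * s) : ℝ) : ℂ) * Complex.I) = 0 := by
  have hr : 0 < x * √(1 + s ^ 2) := mul_pos hx.1 (Real.sqrt_pos.2 (by positivity))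
  have h1 := Real.neg_pi_div_two_lt_arctan s
  have h2 := Real.arctan_lt_pi_div_two s
  have hπ := Real.pi_pos
  rw [polar_of_right, logSolution_polar hr ⟨by linarith, by linarith⟩]
  have h3 := slopeFun_eq hx h
  rw [mul_neg, Real.sin_neg, Real.cos_neg]
  refine mul_eq_zero_of_right _ ?_
  linear_combination 3 / 4 * h3

theorem logPotential_re_eq_zero_of_slopeFun {x s : ℝ} (hx : x ∈ Ioo (0 : ℝ) 1)
    (h : slopeFun (Real.pi / 3) s = negInvLog x) :
    (logPotential (((-x : ℝ) : ℂ) + ((-(x * s) : ℝ) : ℂ) * Complex.I)).re = 0 := by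
  have hr : 0 < x * √(1 + s ^ 2) := mul_pos hx.1 (Real.sqrt_pos.2 (by positivity))
  have h1 := Real.neg_pi_div_two_lt_arctan s
  have h2 := Real.arctan_lt_pi_div_two s
  have hπ := Real.pi_pos
  have h3 := slopeFun_eq hx h
  have hr' : ((x * √(1 + s ^ 2) : ℝ) : ℂ) ≠ 0 := by exact_mod_cast hr.ne'
  have hc : Real.cos (3 / 2 * (Real.pi + Real.arctan s)) = Real.sin (3 / 2 * Real.arctan s) := by
    rw [show 3 / 2 * (Real.pi + Real.arctan s) =
      3 / 2 * Real.arctan s + Real.pi / 2 + Real.pi by ring, Real.cos_add_pi,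
      Real.cos_add_pi_div_two, neg_neg]
  have hsn : Real.sin (3 / 2 * (Real.pi + Real.arctan s)) = -Real.cos (3 / 2 * Real.arctan s) := by
    rw [show 3 / 2 * (Real.pi + Real.arctan s) =
      3 / 2 * Real.arctan s + Real.pi / 2 + Real.pi by ring, Real.sin_add_pi,
      Real.sin_add_pi_div_two]
  rw [polar_of_left, logPotential_re (mul_ne_zero hr' (Complex.exp_ne_zero _)),
    polarAngle_polar hr ⟨by linarith, by linarith⟩, norm_mul, Complex.norm_exp_ofReal_mul_I,
    Complex.norm_real, Real.norm_of_nonneg hr.le, mul_one, hc, hsn]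
  refine mul_eq_zero_of_right _ ?_
  linear_combination -(3 / 4) * h3

/-- The boundary near the junction: the graph of a `C¹` function, flat at `0` to first order but with
slope of order `1 / log x`, whose right half lies in the zero set of `logSolution` and whose left half
lies in the zero set of the harmonic conjugate. -/
theorem exists_boundary_graph :
    ∃ (h : ℝ → ℝ) (d : ℝ), ContDiff ℝ 1 h ∧ h 0 = 0 ∧ HasDerivAt h 0 0 ∧ d ≠ 0 ∧
      Tendsto (fun x => h x * Real.log x / x) (𝓝[>] 0) (𝓝 d) ∧
      (∀ᶠ x : ℝ in 𝓝[>] 0, logSolution ((x : ℂ) + (h x : ℂ) * Complex.I) = 0) ∧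
      ∀ᶠ x : ℝ in 𝓝[<] 0, (logPotential ((x : ℂ) + (h x : ℂ) * Complex.I)).re = 0 := by
  have hπ := Real.pi_pos
  obtain ⟨S, d, hS, hS0, hd, hSd, hSr⟩ := exists_slopeFun_inverse (c := 2 * Real.pi / 3) (by positivity)
  obtain ⟨T, d', hT, hT0, -, -, hTr⟩ := exists_slopeFun_inverse (c := Real.pi / 3) (by positivity)
  have hneg : ContDiffAt ℝ 1 (fun x : ℝ => logTwist T (-x)) 0 := by
    refine ContDiffAt.comp (g := logTwist T) (f := fun x : ℝ => -x) 0 ?_ contDiffAt_id.neg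
    simpa using contDiffAt_logTwist hT hT0
  have hg : ContDiffAt ℝ 1 (fun x : ℝ => -logTwist S x - logTwist T (-x)) 0 :=
    (contDiffAt_logTwist hS hS0).neg.sub hneg
  obtain ⟨h, hh, hhe⟩ := exists_contDiff_eventuallyEq hg
  have hpos : ∀ᶠ x in 𝓝[>] (0 : ℝ), h x = -(x * S (negInvLog x)) := by
    filter_upwards [hhe.filter_mono nhdsWithin_le_nhds, self_mem_nhdsWithin] with x hx hx0
    have hx0 : 0 < x := hx0
    rw [hx, logTwist_of_nonneg S hx0.le, logTwist_of_nonpos hT0 (by linarith), sub_zero]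
  have hlt : ∀ᶠ x in 𝓝[<] (0 : ℝ), h x = -((-x) * T (negInvLog (-x))) := by
    filter_upwards [hhe.filter_mono nhdsWithin_le_nhds, self_mem_nhdsWithin] with x hx hx0
    have hx0 : x < 0 := hx0
    rw [hx, logTwist_of_nonpos hS0 hx0.le, logTwist_of_nonneg T (by linarith), neg_zero, zero_sub]
  have hnl : Tendsto negInvLog (𝓝 0) (𝓝 0) := by
    simpa [negInvLog_zero] using (continuousAt_negInvLog (x := 0) (by simp)).tendsto
  refine ⟨h, d, hh, ?_, ?_, hd, ?_, ?_, ?_⟩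
  · rw [hhe.eq_of_nhds]; simp [logTwist]
  · have h1 := (hasDerivAt_logTwist_zero hS.continuousAt hS0).neg
    have h2 : HasDerivAt (fun x : ℝ => logTwist T (-x)) (0 * (-1)) 0 := by
      refine HasDerivAt.comp (h₂ := logTwist T) (h := fun x : ℝ => -x) 0 ?_ (hasDerivAt_neg 0)
      simpa using hasDerivAt_logTwist_zero hT.continuousAt hT0
    simpa using (h1.sub h2).congr_of_eventuallyEq hhe
  · have hsl := hasDerivAt_iff_tendsto_slope.1 hSd
    have hnl' : Tendsto negInvLog (𝓝[>] 0) (𝓝[≠] 0) := by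
      refine tendsto_nhdsWithin_iff.2 ⟨hnl.mono_left nhdsWithin_le_nhds, ?_⟩
      filter_upwards [Ioo_mem_nhdsGT (zero_lt_one (α := ℝ))] with x hx
      simpa [negInvLog] using ⟨hx.1.ne', hx.2.ne, (by linarith [hx.1] : x ≠ -1)⟩
    refine (hsl.comp hnl').congr' ?_
    filter_upwards [hpos, Ioo_mem_nhdsGT (zero_lt_one (α := ℝ))] with x hx hx1
    have hl : Real.log x ≠ 0 := (Real.log_neg hx1.1 hx1.2).ne
    have hx0 := hx1.1.ne'
    simp only [Function.comp, slope_def_field, hS0, sub_zero]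
    rw [hx]
    generalize S (negInvLog x) = y
    rw [negInvLog]
    field_simp
  · filter_upwards [hpos, Ioo_mem_nhdsGT (zero_lt_one (α := ℝ)),
      (hnl.mono_left nhdsWithin_le_nhds).eventually hSr] with x hx hx1 hxS
    rw [hx]
    exact logSolution_eq_zero_of_slopeFun hx1 hxS
  · have hn : Tendsto (fun x : ℝ => negInvLog (-x)) (𝓝[<] 0) (𝓝 0) := by
      refine hnl.comp ?_
      simpa using ((continuous_neg (G := ℝ)).tendsto 0).mono_left (nhdsWithin_le_nhds (s := Iio 0))
    filter_upwards [hlt, Ioo_mem_nhdsLT (neg_one_lt_zero : (-1 : ℝ) < 0),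
      hn.eventually hTr] with x hx hx1 hxS
    rw [hx]
    have := logPotential_re_eq_zero_of_slopeFun (x := -x) ⟨by linarith [hx1.2], by linarith [hx1.1]⟩ hxS
    rwa [neg_neg] at this

/-! ### The rounded square and its shear -/

/-- The squared distance of `t` to the interval `[-ε, ε]`. -/
noncomputable def sqDistIcc (ε t : ℝ) : ℝ := max (t - ε) 0 ^ 2 + max (-t - ε) 0 ^ 2

theorem hasDerivAt_max_zero_sq (t : ℝ) : HasDerivAt (fun t : ℝ => max t 0 ^ 2) (2 * max t 0) t := by
  rcases lt_trichotomy t 0 with h | h | h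
  · rw [max_eq_right h.le, mul_zero]
    refine (hasDerivAt_const t (0 : ℝ)).congr_of_eventuallyEq ?_
    filter_upwards [Iio_mem_nhds h] with y hy
    rw [max_eq_right (le_of_lt hy)]; norm_num
  · subst h
    rw [hasDerivAt_iff_tendsto_slope]
    have h1 : Tendsto (fun t : ℝ => max t 0) (𝓝[≠] 0) (𝓝 (max 0 0)) :=
      ((continuous_id.max continuous_const).tendsto 0).mono_left nhdsWithin_le_nhds
    rw [max_self] at h1 ⊢
    rw [mul_zero]
    refine h1.congr' ?_
    filter_upwards [self_mem_nhdsWithin] with x hx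
    have hx : x ≠ 0 := hx
    rw [slope_def_field]
    rcases lt_or_gt_of_ne hx with h | h
    · simp [max_eq_right h.le]
    · simp [max_eq_left h.le]; field_simp
  · rw [max_eq_left h.le]
    refine ((hasDerivAt_id t).pow 2).congr_of_eventuallyEq ?_ |>.congr_deriv (by simp)
    filter_upwards [Ioi_mem_nhds h] with y hy
    rw [max_eq_left (le_of_lt hy)]; rfl

theorem hasDerivAt_sqDistIcc (ε t : ℝ) :
    HasDerivAt (sqDistIcc ε) (2 * max (t - ε) 0 - 2 * max (-t - ε) 0) t := by
  have h1 := (hasDerivAt_max_zero_sq (t - ε)).comp t ((hasDerivAt_id t).sub_const ε)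
  have h2 := (hasDerivAt_max_zero_sq (-t - ε)).comp t ((hasDerivAt_id t).neg.sub_const ε)
  refine (h1.add h2).congr_deriv ?_
  ring

theorem contDiff_sqDistIcc (ε : ℝ) : ContDiff ℝ 1 (sqDistIcc ε) := by
  refine contDiff_one_iff_deriv.2 ⟨fun t => (hasDerivAt_sqDistIcc ε t).differentiableAt, ?_⟩
  rw [funext fun t => (hasDerivAt_sqDistIcc ε t).deriv]
  fun_prop

theorem two_mul_sqDistIcc_le {ε : ℝ} (hε : 0 ≤ ε) (t : ℝ) :
    2 * sqDistIcc ε t ≤ (2 * max (t - ε) 0 - 2 * max (-t - ε) 0) * t := by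
  unfold sqDistIcc
  rcases max_cases (t - ε) 0 with ⟨h1, h1'⟩ | ⟨h1, h1'⟩ <;>
  rcases max_cases (-t - ε) 0 with ⟨h2, h2'⟩ | ⟨h2, h2'⟩ <;> rw [h1, h2] <;> nlinarith

theorem sqDistIcc_nonneg (ε t : ℝ) : 0 ≤ sqDistIcc ε t := by unfold sqDistIcc; positivity

theorem sqDistIcc_eq_zero {ε t : ℝ} (h : |t| ≤ ε) : sqDistIcc ε t = 0 := by
  obtain ⟨h1, h2⟩ := abs_le.1 h
  rw [sqDistIcc, max_eq_right (by linarith), max_eq_right (by linarith)]; norm_num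

theorem sqDistIcc_of_le {ε t : ℝ} (hε : 0 ≤ ε) (h : t ≤ -ε) : sqDistIcc ε t = (t + ε) ^ 2 := by
  rw [sqDistIcc, max_eq_right (by linarith), max_eq_left (by linarith)]; ring

theorem abs_le_of_sqDistIcc_lt {ε t : ℝ} (hε : 0 < ε) (h : sqDistIcc ε t < ε ^ 2) :
    |t| ≤ 2 * ε := by
  unfold sqDistIcc at h
  rw [abs_le]
  constructor
  · nlinarith [le_max_left (-t - ε) 0, le_max_right (-t - ε) 0, sq_nonneg (max (t - ε) 0)]
  · nlinarith [le_max_left (t - ε) 0, le_max_right (t - ε) 0, sq_nonneg (max (-t - ε) 0)]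

theorem convexOn_sqDistIcc (ε : ℝ) : ConvexOn ℝ univ (sqDistIcc ε) := by
  have hid : ConvexOn ℝ univ (fun t : ℝ => t) := convexOn_id convex_univ
  have hneg : ConvexOn ℝ univ (fun t : ℝ => -t) := (concaveOn_id convex_univ).neg
  have h1 : ConvexOn ℝ univ (fun t : ℝ => max (t - ε) 0) :=
    (hid.sub (concaveOn_const ε convex_univ)).sup (convexOn_const 0 convex_univ)
  have h2 : ConvexOn ℝ univ (fun t : ℝ => max (-t - ε) 0) :=
    (hneg.sub (concaveOn_const ε convex_univ)).sup (convexOn_const 0 convex_univ)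
  exact (h1.pow (fun _ _ => le_max_right _ _) 2).add (h2.pow (fun _ _ => le_max_right _ _) 2)

/-- The set `{roundedSquare ε < 0}` consists of the points at distance less than `ε` from the square
`[-ε, ε] × [ε, 3ε]`; its boundary contains the segment `[-ε, ε]` of the real axis. -/
noncomputable def roundedSquare (ε : ℝ) (w : ℂ) : ℝ :=
  sqDistIcc ε w.re + sqDistIcc ε (w.im - 2 * ε) - ε ^ 2

/-- The shear that carries the real axis to the graph of `h`. -/
noncomputable def graphShear (h : ℝ → ℝ) (w : ℂ) : ℂ := w + (h w.re : ℂ) * Complex.I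

/-- The function `roundedSquare ε` transported by the shear `graphShear h`. -/
noncomputable def graphDomainFun (h : ℝ → ℝ) (ε : ℝ) (z : ℂ) : ℝ :=
  sqDistIcc ε z.re + sqDistIcc ε (z.im - h z.re - 2 * ε) - ε ^ 2

/-- A rounded square, sheared so that the flat part of its lower side becomes the graph of `h` over
`[-ε, ε]`. -/
def graphDomain (h : ℝ → ℝ) (ε : ℝ) : Set ℂ := {z | graphDomainFun h ε z < 0}

/-- The open arc of the graph of `h` over the interval `(a, b)`. -/
def graphArc (h : ℝ → ℝ) (a b : ℝ) : Set ℂ :=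
  (fun x : ℝ => (x : ℂ) + (h x : ℂ) * Complex.I) '' Ioo a b

theorem mem_graphArc {h : ℝ → ℝ} {a b : ℝ} {z : ℂ} :
    z ∈ graphArc h a b ↔ z.re ∈ Ioo a b ∧ z.im = h z.re := by
  constructor
  · rintro ⟨x, hx, rfl⟩
    simpa using hx
  · rintro ⟨h1, h2⟩
    refine ⟨z.re, h1, ?_⟩
    simp only [← h2, Complex.re_add_im]

theorem contDiff_graphDomainFun {h : ℝ → ℝ} (hh : ContDiff ℝ 1 h) (ε : ℝ) :
    ContDiff ℝ 1 (graphDomainFun h ε) := by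
  have hre : ContDiff ℝ 1 (fun z : ℂ => z.re) := Complex.reCLM.contDiff
  have him : ContDiff ℝ 1 (fun z : ℂ => z.im) := Complex.imCLM.contDiff
  exact (((contDiff_sqDistIcc ε).comp hre).add ((contDiff_sqDistIcc ε).comp
    ((him.sub (hh.comp hre)).sub contDiff_const))).sub contDiff_const

theorem continuous_graphShear {h : ℝ → ℝ} (hh : Continuous h) : Continuous (graphShear h) := by
  unfold graphShear; fun_prop

theorem graphDomain_eq_image (h : ℝ → ℝ) (ε : ℝ) :
    graphDomain h ε = graphShear h '' {w | roundedSquare ε w < 0} := by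
  ext z
  constructor
  · intro hz
    refine ⟨z - (h z.re : ℂ) * Complex.I, ?_, ?_⟩
    · simpa [roundedSquare, graphDomain, graphDomainFun] using hz
    · simp [graphShear]
  · rintro ⟨w, hw, rfl⟩
    simpa [roundedSquare, graphDomain, graphDomainFun, graphShear] using hw

theorem isOpen_graphDomain {h : ℝ → ℝ} (hh : ContDiff ℝ 1 h) (ε : ℝ) :
    IsOpen (graphDomain h ε) :=
  isOpen_lt (contDiff_graphDomainFun hh ε).continuous continuous_const

theorem frontier_graphDomain_subset {h : ℝ → ℝ} (hh : ContDiff ℝ 1 h) (ε : ℝ) :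
    frontier (graphDomain h ε) ⊆ {z | graphDomainFun h ε z = 0} :=
  frontier_lt_subset_eq (contDiff_graphDomainFun hh ε).continuous continuous_const

theorem closure_graphDomain_subset {h : ℝ → ℝ} (hh : ContDiff ℝ 1 h) (ε : ℝ) :
    closure (graphDomain h ε) ⊆ {z | graphDomainFun h ε z ≤ 0} :=
  closure_lt_subset_le (contDiff_graphDomainFun hh ε).continuous continuous_const

theorem isConnected_graphDomain {h : ℝ → ℝ} (hh : Continuous h) {ε : ℝ} (hε : 0 < ε) :
    IsConnected (graphDomain h ε) := by
  rw [graphDomain_eq_image]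
  refine IsConnected.image ⟨⟨((2 * ε : ℝ) : ℂ) * Complex.I, ?_⟩, ?_⟩ _
    (continuous_graphShear hh).continuousOn
  · have : sqDistIcc ε 0 = 0 := sqDistIcc_eq_zero (by simpa using hε.le)
    simp [roundedSquare, this, pow_pos hε]
  · have h1 : ConvexOn ℝ univ fun w : ℂ => sqDistIcc ε w.re :=
      (convexOn_sqDistIcc ε).comp_linearMap Complex.reLm
    have h2 : ConvexOn ℝ univ fun w : ℂ => sqDistIcc ε (w.im - 2 * ε) := by
      have h3 : ConvexOn ℝ univ fun y : ℝ => sqDistIcc ε (y - 2 * ε) := by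
        simpa [Function.comp_def, sub_eq_add_neg, add_comm] using
          (convexOn_sqDistIcc ε).translate_left (-(2 * ε))
      exact h3.comp_linearMap Complex.imLm
    have h4 : ConvexOn ℝ univ (roundedSquare ε) :=
      (h1.add h2).sub (concaveOn_const (ε ^ 2) convex_univ)
    simpa using (h4.convex_lt 0).isPreconnected

theorem isBounded_graphDomain {h : ℝ → ℝ} (hh : Continuous h) {ε : ℝ} (hε : 0 < ε) :
    Bornology.IsBounded (graphDomain h ε) := by
  have hK : IsCompact (Icc (-(2 * ε)) (2 * ε) ×ℂ Icc 0 (4 * ε)) := isCompact_Icc.reProdIm isCompact_Icc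
  refine (hK.image (continuous_graphShear hh)).isBounded.subset ?_
  rw [graphDomain_eq_image]
  refine image_mono fun w hw => ?_
  have hw : sqDistIcc ε w.re + sqDistIcc ε (w.im - 2 * ε) - ε ^ 2 < 0 := hw
  have h1 := abs_le.1 (abs_le_of_sqDistIcc_lt hε (t := w.re)
    (by linarith [sqDistIcc_nonneg ε (w.im - 2 * ε)]))
  have h2 := abs_le.1 (abs_le_of_sqDistIcc_lt hε (t := w.im - 2 * ε)
    (by linarith [sqDistIcc_nonneg ε w.re]))
  rw [Complex.mem_reProdIm]
  exact ⟨h1, by linarith [h2.1], by linarith [h2.2]⟩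

/-- The gradient does not vanish on the boundary: in the coordinates straightened by the shear, the
derivative in the radial direction from the centre of the square is at least `2ε²` there. -/
theorem fderiv_graphDomainFun_ne_zero {h : ℝ → ℝ} (hh : ContDiff ℝ 1 h) {ε : ℝ} (hε : 0 < ε) {p : ℂ}
    (hp : graphDomainFun h ε p = 0) : fderiv ℝ (graphDomainFun h ε) p ≠ 0 := by
  intro h0
  set η : ℝ := p.im - h p.re - 2 * ε with hη
  let cre : ℝ → ℝ := fun t => p.re + t * p.re
  let cim : ℝ → ℝ := fun t => η + t * η
  let c : ℝ → ℂ := fun t => (cre t : ℂ) + ((cim t + 2 * ε + h (cre t) : ℝ) : ℂ) * Complex.I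
  have hc0 : c 0 = p := by
    apply Complex.ext <;> simp [c, cre, cim, hη]
  have hcre : HasDerivAt cre p.re 0 := by
    have := ((hasDerivAt_id (0 : ℝ)).mul_const p.re).const_add p.re
    rwa [one_mul] at this
  have hcim : HasDerivAt cim η 0 := by
    have := ((hasDerivAt_id (0 : ℝ)).mul_const η).const_add η
    rwa [one_mul] at this
  have hcd : DifferentiableAt ℝ c 0 := by
    have h1 : Differentiable ℝ h := hh.differentiable one_ne_zero
    have h2 : DifferentiableAt ℝ (fun t => cim t + 2 * ε + h (cre t)) 0 :=
      (hcim.differentiableAt.add_const _).add ((h1 _).comp 0 hcre.differentiableAt)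
    exact (Complex.ofRealCLM.differentiableAt.comp 0 hcre.differentiableAt).add
      ((Complex.ofRealCLM.differentiableAt.comp 0 h2).mul_const _)
  have hG : HasFDerivAt (graphDomainFun h ε) (0 : ℂ →L[ℝ] ℝ) (c 0) := by
    rw [hc0, ← h0]
    exact ((contDiff_graphDomainFun hh ε).differentiable one_ne_zero p).hasFDerivAt
  have hd1 : HasDerivAt (graphDomainFun h ε ∘ c) 0 0 := by
    simpa using hG.comp_hasDerivAt 0 hcd.hasDerivAt
  have hd2 : HasDerivAt (graphDomainFun h ε ∘ c)
      ((2 * max (p.re - ε) 0 - 2 * max (-p.re - ε) 0) * p.re +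
        (2 * max (η - ε) 0 - 2 * max (-η - ε) 0) * η) 0 := by
    have e1 : graphDomainFun h ε ∘ c = fun t => sqDistIcc ε (cre t) + sqDistIcc ε (cim t) - ε ^ 2 := by
      funext t
      simp only [Function.comp, graphDomainFun, c]
      simp
    rw [e1]
    have e2 := hasDerivAt_sqDistIcc ε p.re
    have e3 := hasDerivAt_sqDistIcc ε η
    have e4 : cre 0 = p.re := by simp [cre]
    have e5 : cim 0 = η := by simp [cim]
    exact (((e4 ▸ e2 : HasDerivAt (sqDistIcc ε) _ (cre 0)).comp 0 hcre).add
      ((e5 ▸ e3 : HasDerivAt (sqDistIcc ε) _ (cim 0)).comp 0 hcim)).sub_const (ε ^ 2)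
  have h3 := hd1.unique hd2
  have h4 := two_mul_sqDistIcc_le hε.le p.re
  have h5 := two_mul_sqDistIcc_le hε.le η
  have h6 : sqDistIcc ε p.re + sqDistIcc ε η - ε ^ 2 = 0 := hp
  nlinarith [sq_pos_of_pos hε]

theorem boundaryC1At_graphDomain {h : ℝ → ℝ} (hh : ContDiff ℝ 1 h) {ε : ℝ} (hε : 0 < ε) {p : ℂ}
    (hp : p ∈ frontier (graphDomain h ε)) : BoundaryC1At (graphDomain h ε) p := by
  have hG := contDiff_graphDomainFun hh ε
  refine ⟨{z | fderiv ℝ (graphDomainFun h ε) z ≠ 0}, graphDomainFun h ε, ?_, ?_, hG.contDiffOn,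
    fun z hz => hz, ?_⟩
  · exact isOpen_ne_fun (hG.continuous_fderiv one_ne_zero) continuous_const
  · exact fderiv_graphDomainFun_ne_zero hh hε (frontier_graphDomain_subset hh ε hp)
  · ext z; exact and_comm

/-! ### The domain near the graph -/

/-- The open set in which the sheared domain is the region above the graph of `h`. -/
def graphNhd (h : ℝ → ℝ) (ε : ℝ) : Set ℂ := {z | |z.re| < ε ∧ z.im - h z.re < ε}

theorem isOpen_graphNhd {h : ℝ → ℝ} (hh : Continuous h) (ε : ℝ) : IsOpen (graphNhd h ε) :=
  (isOpen_lt (f := fun z : ℂ => |z.re|) (by fun_prop) continuous_const).inter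
    (isOpen_lt (f := fun z : ℂ => z.im - h z.re) (by fun_prop) continuous_const)

theorem graphDomainFun_of_mem_graphNhd {h : ℝ → ℝ} {ε : ℝ} (hε : 0 < ε) {z : ℂ}
    (hz : z ∈ graphNhd h ε) :
    graphDomainFun h ε z = (z.im - h z.re - ε) ^ 2 - ε ^ 2 := by
  rw [graphDomainFun, sqDistIcc_eq_zero hz.1.le, sqDistIcc_of_le hε.le (by linarith [hz.2])]
  ring

theorem mem_graphDomain_iff {h : ℝ → ℝ} {ε : ℝ} (hε : 0 < ε) {z : ℂ} (hz : z ∈ graphNhd h ε) :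
    z ∈ graphDomain h ε ↔ h z.re < z.im := by
  rw [graphDomain, mem_ofPred_eq, graphDomainFun_of_mem_graphNhd hε hz]
  have := hz.2
  constructor <;> intro h <;> nlinarith

theorem mem_frontier_graphDomain_iff {h : ℝ → ℝ} (hh : ContDiff ℝ 1 h) {ε : ℝ} (hε : 0 < ε) {z : ℂ}
    (hz : z ∈ graphNhd h ε) : z ∈ frontier (graphDomain h ε) ↔ z.im = h z.re := by
  constructor
  · intro hf
    have h1 : graphDomainFun h ε z = 0 := frontier_graphDomain_subset hh ε hf
    rw [graphDomainFun_of_mem_graphNhd hε hz] at h1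
    have h2 : (z.im - h z.re) * (z.im - h z.re - 2 * ε) = 0 := by linarith
    rcases mul_eq_zero.1 h2 with h3 | h3
    · linarith
    · linarith [hz.2]
  · intro him
    rw [frontier, (isOpen_graphDomain hh ε).interior_eq]
    refine ⟨?_, fun hm => ((mem_graphDomain_iff hε hz).1 hm).ne' him⟩
    -- `z` is the limit of the points of the domain vertically above it
    have hc : Continuous fun t : ℝ => z + (t : ℂ) * Complex.I := by fun_prop
    have ht : Tendsto (fun t : ℝ => z + (t : ℂ) * Complex.I) (𝓝[>] 0) (𝓝 z) := by
      simpa using (hc.tendsto 0).mono_left (nhdsWithin_le_nhds (s := Ioi 0))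
    refine mem_closure_of_tendsto ht ?_
    filter_upwards [ht.eventually ((isOpen_graphNhd hh.continuous ε).mem_nhds hz),
      self_mem_nhdsWithin] with t h1 h2
    refine (mem_graphDomain_iff hε h1).2 ?_
    have h2 : 0 < t := h2
    simp [him, h2]

theorem hasFDerivAt_graph {h : ℝ → ℝ} {h' : ℝ} {z : ℂ} (hh : HasDerivAt h h' z.re) :
    HasFDerivAt (fun z : ℂ => h z.re - z.im) (h' • Complex.reCLM - Complex.imCLM) z :=
  (hh.comp_hasFDerivAt z Complex.reCLM.hasFDerivAt).sub Complex.imCLM.hasFDerivAt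

theorem isDefiningFunctionOn_graph {h : ℝ → ℝ} (hh : ContDiff ℝ 1 h) {ε : ℝ} (hε : 0 < ε) :
    IsDefiningFunctionOn (graphDomain h ε) (graphNhd h ε) (fun z => h z.re - z.im) := by
  refine ⟨?_, fun z _ h0 => ?_, ?_⟩
  · exact ((hh.comp Complex.reCLM.contDiff).sub Complex.imCLM.contDiff).contDiffOn
  · have h1 := (hasFDerivAt_graph (z := z) (hh.differentiable one_ne_zero z.re).hasDerivAt).fderiv
    rw [h0] at h1
    simpa using DFunLike.congr_fun h1 Complex.I
  · ext z
    constructor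
    · rintro ⟨h1, h2⟩
      exact ⟨h2, sub_neg.2 ((mem_graphDomain_iff hε h2).1 h1)⟩
    · rintro ⟨h1, h2⟩
      exact ⟨(mem_graphDomain_iff hε h1).2 (sub_neg.1 h2), h1⟩

theorem mem_graphNhd_of_im_eq {h : ℝ → ℝ} {ε : ℝ} (hε : 0 < ε) {z : ℂ} (h1 : |z.re| < ε)
    (h2 : z.im = h z.re) : z ∈ graphNhd h ε := ⟨h1, by rw [h2]; simpa using hε⟩

theorem isOuterUnitNormal_graph {h : ℝ → ℝ} (hh : ContDiff ℝ 1 h) {ε : ℝ} (hε : 0 < ε) {z : ℂ}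
    {h' : ℝ} (hd : HasDerivAt h h' z.re) (hz1 : |z.re| < ε) (hz2 : z.im = h z.re) :
    IsOuterUnitNormal (graphDomain h ε) z (((√(1 + h' ^ 2))⁻¹ : ℝ) * ((h' : ℂ) - Complex.I)) := by
  have hz := mem_graphNhd_of_im_eq hε hz1 hz2
  have hpos : 0 < √(1 + h' ^ 2) := Real.sqrt_pos.2 (by positivity)
  refine ⟨(mem_frontier_graphDomain_iff hh hε hz).2 hz2, ?_, graphNhd h ε, _,
    isOpen_graphNhd hh.continuous ε, hz, isDefiningFunctionOn_graph hh hε, √(1 + h' ^ 2), hpos, ?_⟩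
  · have h1 : ‖(h' : ℂ) - Complex.I‖ = √(1 + h' ^ 2) := by
      rw [Complex.norm_eq_sqrt_sq_add_sq]
      simp [add_comm]
    rw [norm_mul, h1, Complex.norm_real, Real.norm_of_nonneg (inv_nonneg.2 hpos.le),
      inv_mul_cancel₀ hpos.ne']
  · intro v
    rw [(hasFDerivAt_graph hd).fderiv]
    simp [Complex.inner]
    field_simp

theorem isBoundaryArc_graphArc {h : ℝ → ℝ} (hh : ContDiff ℝ 1 h) {ε : ℝ} (hε : 0 < ε) {a b : ℝ}
    (hab : a < b) (ha : -ε ≤ a) (hb : b ≤ ε) : IsBoundaryArc (graphDomain h ε) (graphArc h a b) := by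
  have hcont := hh.continuous
  refine ⟨?_, ?_, graphNhd h ε ∩ {z | z.re ∈ Ioo a b}, ?_, ?_⟩
  · exact (isConnected_Ioo hab).image _ (by fun_prop)
  · exact (Ioo_infinite hab).nontrivial.image fun x y hxy => by simpa using congrArg Complex.re hxy
  · exact (isOpen_graphNhd hcont ε).inter (isOpen_Ioo.preimage Complex.continuous_re)
  · ext z
    rw [mem_graphArc]
    constructor
    · rintro ⟨h1, h2⟩
      have hz := mem_graphNhd_of_im_eq hε (abs_lt.2 ⟨ha.trans_lt h1.1, h1.2.trans_le hb⟩) h2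
      exact ⟨(mem_frontier_graphDomain_iff hh hε hz).2 h2, hz, h1⟩
    · rintro ⟨h1, h2, h3⟩
      exact ⟨h3, (mem_frontier_graphDomain_iff hh hε h2).1 h1⟩

theorem zero_mem_closure_graphArc {h : ℝ → ℝ} (hh : Continuous h) (h0 : h 0 = 0) {a b : ℝ}
    (hab : a < b) (ha : a ≤ 0) (hb : 0 ≤ b) : (0 : ℂ) ∈ closure (graphArc h a b) := by
  have hc : Continuous fun x : ℝ => (x : ℂ) + (h x : ℂ) * Complex.I := by fun_prop
  have h1 : (0 : ℝ) ∈ closure (Ioo a b) := by rw [closure_Ioo hab.ne]; exact ⟨ha, hb⟩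
  have h2 := image_closure_subset_closure_image hc (mem_image_of_mem _ h1)
  simpa [h0, graphArc] using h2

theorem isJunctionDomain_graphDomain {h : ℝ → ℝ} (hh : ContDiff ℝ 1 h) (h0 : h 0 = 0)
    (hd : HasDerivAt h 0 0) {ε : ℝ} (hε : 0 < ε) :
    IsJunctionDomain (graphDomain h ε) (graphArc h 0 ε) (graphArc h (-ε) 0) where
  isOpen := isOpen_graphDomain hh ε
  isConnected := isConnected_graphDomain hh.continuous hε
  isBounded := isBounded_graphDomain hh.continuous hε
  normal_zero := by
    have := isOuterUnitNormal_graph hh hε (z := 0) (h' := 0) (by simpa using hd) (by simpa using hε)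
      (by simp [h0])
    simpa using this
  arc_d := isBoundaryArc_graphArc hh hε hε (by linarith) le_rfl
  arc_n := isBoundaryArc_graphArc hh hε (by linarith) le_rfl hε.le
  right_d z hz := (mem_graphArc.1 hz).1.1
  left_n z hz := (mem_graphArc.1 hz).1.2
  closure_inter := by
    have hcont := hh.continuous
    refine Subset.antisymm ?_ ?_
    · have hcl : IsClosed {z : ℂ | 0 ≤ z.re ∧ z.im = h z.re} :=
        (isClosed_le continuous_const Complex.continuous_re).inter
          (isClosed_eq Complex.continuous_im (by fun_prop))
      have h1 : closure (graphArc h 0 ε) ⊆ {z : ℂ | 0 ≤ z.re ∧ z.im = h z.re} :=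
        closure_minimal (fun z hz => ⟨(mem_graphArc.1 hz).1.1.le, (mem_graphArc.1 hz).2⟩) hcl
      have h2 : closure (graphArc h (-ε) 0) ⊆ {z : ℂ | z.re ≤ 0} :=
        closure_minimal (fun z hz => (mem_graphArc.1 hz).1.2.le)
          (isClosed_le Complex.continuous_re continuous_const)
      rintro z ⟨hz1, hz2⟩
      have e1 : z.re = 0 := le_antisymm (h2 hz2) (h1 hz1).1
      have e2 : z.im = 0 := by rw [(h1 hz1).2, e1, h0]
      exact Complex.ext e1 e2
    · rintro z rfl
      exact ⟨zero_mem_closure_graphArc hcont h0 hε le_rfl hε.le,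
        zero_mem_closure_graphArc hcont h0 (by linarith) (by linarith) le_rfl⟩
  near_zero := by
    have h1 : graphNhd h ε ∈ 𝓝 (0 : ℂ) := (isOpen_graphNhd hh.continuous ε).mem_nhds
      (mem_graphNhd_of_im_eq hε (by simpa using hε) (by simp [h0]))
    obtain ⟨δ, hδ, hball⟩ := Metric.mem_nhds_iff.1 h1
    refine ⟨δ, hδ, ?_⟩
    rintro z ⟨hz1, hz2⟩
    have hz := hball hz2
    have him := (mem_frontier_graphDomain_iff hh hε hz).1 hz1
    have hre := abs_lt.1 hz.1
    rcases lt_trichotomy z.re 0 with h2 | h2 | h2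
    · exact Or.inr (mem_graphArc.2 ⟨⟨hre.1, h2⟩, him⟩)
    · exact Or.inl (Or.inr (Complex.ext h2 (by rw [him, h2, h0]; rfl)))
    · exact Or.inl (Or.inl (mem_graphArc.2 ⟨⟨h2, hre.2⟩, him⟩))

/-- On the imaginary axis the closure of the domain lies in the upper half plane, so away from `0` it
avoids the branch cut. -/
theorem mem_slit_of_mem_closure {h : ℝ → ℝ} (hh : ContDiff ℝ 1 h) (h0 : h 0 = 0) {ε : ℝ} (hε : 0 < ε)
    {z : ℂ} (hz : z ∈ closure (graphDomain h ε)) (hz0 : z ≠ 0) :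
    -Complex.I * z ∈ Complex.slitPlane := by
  rw [mem_slit_iff]
  by_contra hcon
  push Not at hcon
  obtain ⟨h1, h2⟩ := hcon
  have h3 : z.im < 0 := lt_of_le_of_ne h1 fun h4 => hz0 (Complex.ext h2 h4)
  have hzU : z ∈ graphNhd h ε := ⟨by simpa [h2] using hε, by rw [h2, h0]; linarith⟩
  have h5 : graphDomainFun h ε z ≤ 0 := closure_graphDomain_subset hh ε hz
  rw [graphDomainFun_of_mem_graphNhd hε hzU, h2, h0] at h5
  nlinarith

/-! ### Failure of Hölder regularity -/

/-- The slope of a boundary graph is controlled by the modulus of continuity of the gradient of any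
defining function, hence a Hölder gradient excludes a boundary of order `x / log x`. -/
theorem false_of_gradient_holder {h : ℝ → ℝ} {d : ℝ} (hh : ContDiff ℝ 1 h) (h0 : h 0 = 0)
    (hd0 : HasDerivAt h 0 0) (hd : d ≠ 0)
    (hlog : Tendsto (fun x => h x * Real.log x / x) (𝓝[>] 0) (𝓝 d)) {Ω U : Set ℂ} {G : ℂ → ℝ}
    (hΩ : IsOpen Ω) (hfr : ∀ᶠ x : ℝ in 𝓝 0, (x : ℂ) + (h x : ℂ) * Complex.I ∈ frontier Ω)
    (hU : IsOpen U) (h0U : (0 : ℂ) ∈ U) (hG : IsDefiningFunctionOn Ω U G) {C δ : ℝ} (hδ : 0 < δ)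
    (hC : ∀ᶠ z in 𝓝 (0 : ℂ), ‖fderiv ℝ G z - fderiv ℝ G 0‖ ≤ C * ‖z‖ ^ δ) : False := by
  obtain ⟨hG1, hG2, hG3⟩ := hG
  let γ : ℝ → ℂ := fun x => (x : ℂ) + (h x : ℂ) * Complex.I
  have hγc : Continuous γ := by have := hh.continuous; fun_prop
  have hγ0 : γ 0 = 0 := by simp [γ, h0]
  have hγt : Tendsto γ (𝓝 0) (𝓝 0) := by simpa [hγ0] using hγc.tendsto 0
  have hγd : ∀ x, HasDerivAt γ (1 + ((deriv h x : ℝ) : ℂ) * Complex.I) x := fun x =>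
    (hasDerivAt_id x).ofReal_comp.add
      (((hh.differentiable one_ne_zero x).hasDerivAt.ofReal_comp).mul_const Complex.I)
  -- `G` vanishes along the boundary
  have hGγ : ∀ᶠ x in 𝓝 (0 : ℝ), G (γ x) = 0 := by
    filter_upwards [hfr, hγt.eventually (hU.mem_nhds h0U)] with x hx1 hx2
    rw [frontier, hΩ.interior_eq] at hx1
    refine le_antisymm ?_ (not_lt.1 fun hlt => hx1.2 (hG3.symm.subset ⟨hx2, hlt⟩).1)
    have hcA : ContinuousAt G (γ x) := (hG1.continuousOn).continuousAt (hU.mem_nhds hx2)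
    refine le_of_not_gt fun hgt => ?_
    obtain ⟨w, ⟨hw1, hw2⟩, hw3⟩ := mem_closure_iff_nhds.1 hx1.1 _
      (inter_mem (hcA.eventually (lt_mem_nhds hgt)) (hU.mem_nhds hx2))
    have hw4 : G w < 0 := (hG3.subset ⟨hw3, hw2⟩).2
    exact absurd hw4 (not_lt.2 (le_of_lt hw1))
  -- differentiation along the boundary
  have hrel : ∀ᶠ x in 𝓝 (0 : ℝ),
      fderiv ℝ G (γ x) 1 + deriv h x * fderiv ℝ G (γ x) Complex.I = 0 := by
    filter_upwards [hGγ.eventually_nhds, hγt.eventually (hU.mem_nhds h0U)] with x hx1 hx2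
    have hdG : HasFDerivAt G (fderiv ℝ G (γ x)) (γ x) :=
      ((hG1.contDiffAt (hU.mem_nhds hx2)).differentiableAt one_ne_zero).hasFDerivAt
    have e1 := hdG.comp_hasDerivAt x (hγd x)
    have e2 : HasDerivAt (G ∘ γ) 0 x :=
      (hasDerivAt_const x (0 : ℝ)).congr_of_eventuallyEq hx1
    have e3 := e1.unique e2
    rwa [map_add, ← Complex.real_smul, map_smul, smul_eq_mul] at e3
  have hGx0 : fderiv ℝ G 0 1 = 0 := by
    have := hrel.self_of_nhds
    rwa [hd0.deriv, zero_mul, add_zero, hγ0] at this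
  have hGy0 : fderiv ℝ G 0 Complex.I ≠ 0 := by
    intro hI
    refine hG2 0 h0U (ContinuousLinearMap.ext fun v => ?_)
    have hv : v = v.re • (1 : ℂ) + v.im • Complex.I := by
      simp [Complex.re_add_im]
    rw [hv, map_add, map_smul, map_smul, hGx0, hI]
    simp
  set b : ℝ := |fderiv ℝ G 0 Complex.I| / 2 with hb
  have hbpos : 0 < b := by positivity
  have hGyc : ∀ᶠ x in 𝓝 (0 : ℝ), b < |fderiv ℝ G (γ x) Complex.I| := by
    have e1 : ContinuousAt (fun z => |fderiv ℝ G z Complex.I|) 0 :=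
      (((hG1.contDiffAt (hU.mem_nhds h0U)).continuousAt_fderiv one_ne_zero).clm_apply
        continuousAt_const).abs
    have e2 : b < |fderiv ℝ G 0 Complex.I| := by rw [hb]; linarith [abs_pos.2 hGy0]
    exact hγt.eventually (e1.eventually (lt_mem_nhds e2))
  have hγle : ∀ᶠ x in 𝓝 (0 : ℝ), ‖γ x‖ ≤ 2 * |x| := by
    have e1 := (hasDerivAt_iff_isLittleO.1 hd0).bound one_pos
    filter_upwards [e1] with x hx
    have hx : |h x| ≤ |x| := by simpa [h0] using hx
    calc ‖γ x‖ ≤ ‖(x : ℂ)‖ + ‖(h x : ℂ) * Complex.I‖ := norm_add_le _ _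
      _ = |x| + |h x| := by simp
      _ ≤ 2 * |x| := by linarith
  have hC' : ∀ᶠ z in 𝓝 (0 : ℂ), ‖fderiv ℝ G z - fderiv ℝ G 0‖ ≤ |C| * ‖z‖ ^ δ := by
    filter_upwards [hC] with z hz
    exact hz.trans (mul_le_mul_of_nonneg_right (le_abs_self C) (by positivity))
  set M : ℝ := |C| * 2 ^ δ / b with hM
  have hM0 : 0 ≤ M := by positivity
  have hslope : ∀ᶠ x in 𝓝 (0 : ℝ), |deriv h x| ≤ M * |x| ^ δ := by
    filter_upwards [hrel, hGyc, hγle, hγt.eventually hC'] with x e1 e2 e3 e4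
    have e5 : |fderiv ℝ G (γ x) 1| ≤ |C| * ‖γ x‖ ^ δ := by
      have e6 := (fderiv ℝ G (γ x) - fderiv ℝ G 0).le_opNorm 1
      rw [sub_apply, hGx0, sub_zero, norm_one, mul_one] at e6
      exact e6.trans e4
    have e6 : ‖γ x‖ ^ δ ≤ 2 ^ δ * |x| ^ δ := by
      rw [← Real.mul_rpow two_pos.le (abs_nonneg x)]
      exact Real.rpow_le_rpow (norm_nonneg _) e3 hδ.le
    have e7 : |deriv h x| * |fderiv ℝ G (γ x) Complex.I| = |fderiv ℝ G (γ x) 1| := by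
      rw [← abs_mul, ← abs_neg, ← eq_neg_of_add_eq_zero_left e1]
    have e8 : |deriv h x| * b ≤ |C| * (2 ^ δ * |x| ^ δ) :=
      calc |deriv h x| * b ≤ |deriv h x| * |fderiv ℝ G (γ x) Complex.I| := by gcongr
        _ ≤ |C| * ‖γ x‖ ^ δ := e7 ▸ e5
        _ ≤ _ := by gcongr
    rw [hM, div_mul_eq_mul_div, le_div_iff₀ hbpos]
    linarith
  obtain ⟨ρ, hρ, hball⟩ := Metric.eventually_nhds_iff_ball.1 hslope
  have hbound : ∀ x ∈ Ioo 0 ρ, |h x| ≤ M * x ^ δ * x := by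
    intro x hx
    have := norm_image_sub_le_of_norm_deriv_le_segment' (f := h) (f' := deriv h) (a := 0) (b := x)
      (C := M * x ^ δ) (fun y _ => (hh.differentiable one_ne_zero y).hasDerivAt.hasDerivWithinAt)
      (fun y hy => ?_) x ⟨hx.1.le, le_rfl⟩
    · simpa [h0] using this
    · refine (hball y ?_).trans ?_
      · rw [Metric.mem_ball, Real.dist_eq, sub_zero, abs_of_nonneg hy.1]
        exact hy.2.trans hx.2
      · rw [abs_of_nonneg hy.1]
        have := Real.rpow_le_rpow hy.1 hy.2.le hδ.le
        gcongr
  have hlim : Tendsto (fun x : ℝ => M * |Real.log x * x ^ δ|) (𝓝[>] 0) (𝓝 0) := by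
    simpa using (tendsto_log_mul_rpow_nhdsGT_zero hδ).abs.const_mul M
  refine hd (tendsto_nhds_unique hlog (squeeze_zero_norm' ?_ hlim))
  filter_upwards [Ioo_mem_nhdsGT hρ] with x hx
  have hx0 := hx.1
  rw [Real.norm_eq_abs, abs_div, abs_mul, abs_mul, abs_of_pos hx0,
    abs_of_pos (Real.rpow_pos_of_pos hx0 δ), div_le_iff₀ hx0]
  have := mul_le_mul_of_nonneg_right (hbound x hx) (abs_nonneg (Real.log x))
  linarith

theorem not_boundaryHolderAt_graph {h : ℝ → ℝ} {d : ℝ} (hh : ContDiff ℝ 1 h) (h0 : h 0 = 0)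
    (hd0 : HasDerivAt h 0 0) (hd : d ≠ 0)
    (hlog : Tendsto (fun x => h x * Real.log x / x) (𝓝[>] 0) (𝓝 d)) {ε : ℝ} (hε : 0 < ε)
    {δ : ℝ≥0} (hδ : 0 < δ) :
    ¬ BoundaryHolderAt 1 δ (graphDomain h ε) 0 ∧ ¬ BoundaryHolderAt 2 δ (graphDomain h ε) 0 := by
  have hfr : ∀ᶠ x : ℝ in 𝓝 0, (x : ℂ) + (h x : ℂ) * Complex.I ∈ frontier (graphDomain h ε) := by
    filter_upwards [Ioo_mem_nhds (neg_neg_of_pos hε) hε] with x hx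
    have h1 : |((x : ℂ) + (h x : ℂ) * Complex.I).re| < ε := by simpa [abs_lt] using hx
    have h2 : ((x : ℂ) + (h x : ℂ) * Complex.I).im = h ((x : ℂ) + (h x : ℂ) * Complex.I).re := by simp
    exact (mem_frontier_graphDomain_iff hh hε (mem_graphNhd_of_im_eq hε h1 h2)).2 h2
  have hΩ := isOpen_graphDomain hh ε
  constructor
  · rintro ⟨U, G, hU, h0U, hG, -, C, hC⟩
    refine false_of_gradient_holder hh h0 hd0 hd hlog hΩ hfr hU h0U hG (C := C) (δ := δ)
      (by exact_mod_cast hδ) ?_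
    filter_upwards [hU.mem_nhds h0U] with z hz
    have h1 := hC.dist_le hz h0U
    rw [dist_eq_norm, dist_zero_right] at h1
    refine ContinuousLinearMap.opNorm_le_bound _ (by positivity) fun v => ?_
    have h2 := (iteratedFDeriv ℝ 1 G z - iteratedFDeriv ℝ 1 G 0).le_opNorm fun _ => v
    rw [sub_apply, iteratedFDeriv_one_apply, iteratedFDeriv_one_apply] at h2
    refine h2.trans ?_
    simp only [Finset.univ_unique, Finset.prod_singleton]
    gcongr
  · rintro ⟨U, G, hU, h0U, hG, hG2, -⟩
    have h1 : ContDiffAt ℝ 1 (fderiv ℝ G) 0 :=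
      (hG2.contDiffAt (hU.mem_nhds h0U)).fderiv_right (by norm_num)
    obtain ⟨C, hC⟩ := (h1.differentiableAt one_ne_zero).isBigO_sub.bound
    refine false_of_gradient_holder hh h0 hd0 hd hlog hΩ hfr hU h0U hG (C := C) (δ := 1) one_pos ?_
    filter_upwards [hC] with z hz
    simpa using hz

/-! ### The mixed boundary value problem -/

/-- On an arc of the graph along which the harmonic conjugate `Re logPotential` is constant, the
Cauchy-Riemann equations turn its vanishing tangential derivative into a vanishing normal derivative
of `logSolution`. -/
theorem fderiv_logSolution_normal_eq_zero {h : ℝ → ℝ} {x h' : ℝ} (hd : HasDerivAt h h' x)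
    (hx : -Complex.I * ((x : ℂ) + (h x : ℂ) * Complex.I) ∈ Complex.slitPlane)
    (hre : ∀ᶠ y : ℝ in 𝓝 x, (logPotential ((y : ℂ) + (h y : ℂ) * Complex.I)).re = 0) (c : ℝ) :
    fderiv ℝ logSolution ((x : ℂ) + (h x : ℂ) * Complex.I) (c * ((h' : ℂ) - Complex.I)) = 0 := by
  have hγ : HasDerivAt (fun y : ℝ => (y : ℂ) + (h y : ℂ) * Complex.I) (1 + (h' : ℂ) * Complex.I) x :=
    (hasDerivAt_id x).ofReal_comp.add (hd.ofReal_comp.mul_const Complex.I)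
  have h1 := ((hasDerivAt_logPotential hx).hasFDerivAt.restrictScalars ℝ).comp_hasDerivAt x hγ
  have h2 := Complex.reCLM.hasFDerivAt.comp_hasDerivAt x h1
  have h3 := h2.unique ((hasDerivAt_const x (0 : ℝ)).congr_of_eventuallyEq hre)
  rw [fderiv_logSolution hx]
  simp at h3 ⊢
  linear_combination -c * h3

theorem isMixedHarmonic_logSolution {h : ℝ → ℝ} (hh : ContDiff ℝ 1 h) (h0 : h 0 = 0) {ε : ℝ}
    (hε : 0 < ε)
    (hdir : ∀ x ∈ Ioo 0 ε, logSolution ((x : ℂ) + (h x : ℂ) * Complex.I) = 0)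
    (hneu : ∀ x ∈ Ioo (-ε) 0, (logPotential ((x : ℂ) + (h x : ℂ) * Complex.I)).re = 0) :
    IsMixedHarmonic (graphDomain h ε) (graphArc h 0 ε) (graphArc h (-ε) 0) logSolution := by
  have hbdd := isBounded_graphDomain hh.continuous hε
  have hopen := isOpen_graphDomain hh ε
  have hslit : ∀ z ∈ closure (graphDomain h ε), z ≠ 0 → -Complex.I * z ∈ Complex.slitPlane :=
    fun z hz hz0 => mem_slit_of_mem_closure hh h0 hε hz hz0
  have hfin : IsFiniteMeasure (volume.restrict (graphDomain h ε)) :=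
    isFiniteMeasure_restrict.2 hbdd.measure_lt_top.ne
  have hharm : InnerProductSpace.HarmonicOnNhd logSolution (closure (graphDomain h ε) \ {0}) :=
    fun z hz => harmonicAt_logSolution (hslit z hz.1 hz.2)
  have hcont : ContinuousOn logSolution (closure (graphDomain h ε)) := by
    intro z hz
    by_cases hz0 : z = 0
    · rw [hz0]; exact continuousAt_logSolution_zero.continuousWithinAt
    · exact (hharm z ⟨hz, hz0⟩).1.continuousAt.continuousWithinAt
  have hzero : (0 : ℂ) ∉ graphDomain h ε := by
    rw [mem_graphDomain_iff hε (mem_graphNhd_of_im_eq hε (by simpa using hε) (by simp [h0]))]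
    simp [h0]
  refine ⟨hcont, hharm, ?_, ?_, ?_, ?_⟩
  · obtain ⟨C, hC⟩ := hbdd.isCompact_closure.exists_bound_of_continuousOn hcont
    refine MemLp.of_bound ((hcont.mono subset_closure).aestronglyMeasurable hopen.measurableSet) C ?_
    exact ae_restrict_of_forall_mem hopen.measurableSet fun z hz => hC z (subset_closure hz)
  · obtain ⟨R, hR⟩ := hbdd.exists_norm_le
    obtain ⟨C, hC⟩ := exists_bound_logPotentialDeriv R
    refine MemLp.of_bound (measurable_fderiv ℝ logSolution).aestronglyMeasurable C ?_
    refine ae_restrict_of_forall_mem hopen.measurableSet fun z hz => ?_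
    have hz0 : z ≠ 0 := fun h => hzero (h ▸ hz)
    exact (norm_fderiv_logSolution_le (hslit z (subset_closure hz) hz0)).trans (hC z hz0 (hR z hz))
  · rintro _ ⟨x, hx, rfl⟩
    exact hdir x hx
  · rintro _ ⟨x, hx, rfl⟩
    have hd := (hh.differentiable one_ne_zero x).hasDerivAt
    refine ⟨_, isOuterUnitNormal_graph hh hε (h' := deriv h x) (by simpa using hd)
      (by simpa using abs_lt.2 ⟨hx.1, hx.2.trans hε⟩) (by simp), ?_⟩
    refine fderiv_logSolution_normal_eq_zero hd (mem_slit_iff.2 (Or.inr ?_)) ?_ _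
    · simpa using hx.2.ne
    · filter_upwards [isOpen_Ioo.mem_nhds hx] with y hy
      exact hneu y hy

theorem mainTheorem6 :
    ∃ (Ω Γd Γn : Set ℂ) (u : ℂ → ℝ),
      IsJunctionDomain Ω Γd Γn ∧
      -- the boundary is of class `C¹` everywhere, but neither `C^{1,δ}` nor `C^{2,δ}` near `0`
      (∀ p ∈ frontier Ω, BoundaryC1At Ω p) ∧
      (∀ δ : ℝ≥0, 0 < δ → ¬ BoundaryHolderAt 1 δ Ω 0 ∧ ¬ BoundaryHolderAt 2 δ Ω 0) ∧
      -- the mixed boundary value problem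
      IsMixedHarmonic Ω Γd Γn u ∧
      -- the explicit form of the solution
      (∀ z ∈ closure Ω \ {0},
        u z = ‖z‖ ^ (3 / 2 : ℝ) *
          (3 / 4 * Real.log ‖z‖ * Real.sin (3 / 2 * polarAngle z) +
            (3 / 4 * polarAngle z - Real.pi / 2) * Real.cos (3 / 2 * polarAngle z))) ∧
      -- the dominant term is logarithmic
      ((fun z => u z - 3 / 4 * Real.log ‖z‖ * mixedProfile 2 z)
        =O[𝓝[Ω] 0] fun z => ‖z‖ ^ (3 / 2 : ℝ)) ∧
      -- on every ray but one, no finite sum of powers of `r` reproduces the dominant behaviour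
      (∀ θ ∈ Ioo 0 Real.pi, θ ≠ 2 * Real.pi / 3 → ∀ (s : Finset ℝ) (c : ℝ → ℝ),
        ¬ ((fun r : ℝ => u (r * Complex.exp (θ * Complex.I)) - ∑ γ ∈ s, c γ * r ^ γ)
          =o[𝓝[>] 0] fun r : ℝ => r ^ (3 / 2 : ℝ) * Real.log r)) ∧
      -- no expansion `β F_k ∘ φ + o(|z|^{(2k-1)/2})` holds, `φ` being tangent to a dilation at `0`
      (∀ (k : ℕ) (β α : ℝ) (φ : ℂ → ℂ), 1 ≤ k → β ≠ 0 → 0 < α → φ 0 = 0 →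
        HasDerivWithinAt φ (α : ℂ) Ω 0 →
        ¬ ((fun z => u z - β * mixedProfile k (φ z))
          =o[𝓝[Ω] 0] fun z => ‖z‖ ^ ((2 * (k : ℝ) - 1) / 2))) := by
  obtain ⟨h, d, hh, h0, hd0, hd, hlog, hdir, hneu⟩ := exists_boundary_graph
  obtain ⟨a, ha, hdir⟩ := mem_nhdsGT_iff_exists_Ioo_subset.1 hdir
  obtain ⟨b, hb, hneu⟩ := mem_nhdsLT_iff_exists_Ioo_subset.1 hneu
  have ha : 0 < a := ha
  have hb : b < 0 := hb
  set ε := min a (-b) with hεd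
  have hε : 0 < ε := lt_min ha (neg_pos.2 hb)
  have hεa : ε ≤ a := min_le_left _ _
  have hεb : b ≤ -ε := by linarith [min_le_right a (-b)]
  refine ⟨graphDomain h ε, graphArc h 0 ε, graphArc h (-ε) 0, logSolution,
    isJunctionDomain_graphDomain hh h0 hd0 hε, fun p hp => boundaryC1At_graphDomain hh hε hp,
    fun δ hδ => not_boundaryHolderAt_graph hh h0 hd0 hd hlog hε hδ,
    isMixedHarmonic_logSolution hh h0 hε (fun x hx => hdir ⟨hx.1, hx.2.trans_le hεa⟩)
      (fun x hx => hneu ⟨hεb.trans_lt hx.1, hx.2⟩),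
    fun z _ => rfl, logSolution_sub_isBigO _,
    fun θ hθ hθ' s c => logSolution_ray_not_isLittleO hθ hθ' s c,
    fun k β α φ hk hβ hα hφ0 hφ =>
      logSolution_sub_mixedProfile_comp_not_isLittleO ?_ hk hβ hα hφ0 hφ⟩
  filter_upwards [Ioo_mem_nhdsGT hε] with r hr
  refine (mem_graphDomain_iff hε ⟨?_, ?_⟩).2 ?_ <;> simp [h0, hr.1, hr.2, hε]
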